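/- For a subring $A\subseteq\mathbb{Q}$, a homeomorphism $h$ of the real line is piecewise-$\mathrm{SL}_2(A)$ if the line can be decomposed into finitely many intervals on each of which $h(x)=\frac{ax+b}{cx+d}$ for some $\begin{pmatrix}a&b\\c&d\end{pmatrix}\in\mathrm{SL}_2(A)$. For a set $S$ of primes, let $\Gamma_S$ be the group of all piecewise-$\mathrm{SL}_2(\mathbb{Z}[1/S])$ homeomorphisms of the line. Let $H(\mathbb{Q})$ be the group of all piecewise-$\mathrm{SL}_2(\mathbb{Q})$ homeomorphisms of the line whose breakpoints are fixed points of hyperbolic elements of $\mathrm{SL}_2(\mathbb{Q})$. For a prime $p$, let $K_p$ be the space of measurable maps $f\colon \mathbb{P}^1_{\mathbb{R}}\to\mathrm{Prob}(\mathbb{P}^1_{\mathbb{Q}_p})$, where maps that agree outside a null set are identified and $\mathrm{Prob}(\mathbb{P}^1_{\mathbb{Q}_p})$ has the weak-* topology. The topology of $K_p$ is the weak-* topology obtained by viewing $f$ as the functional $\varphi\mapsto\int_{\mathbb{P}^1_{\mathbb{R}}}\int_{\mathbb{P}^1_{\mathbb{Q}_p}}\varphi(x)(y)\,df(x)(y)\,dx$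 in the dual of $L^1(\mathbb{P}^1_{\mathbb{R}},C(\mathbb{P}^1_{\mathbb{Q}_p}))$. The group $H(\mathbb{Q})$ acts on $K_p$ by $(h.f)(x)=h|_{h^{-1}x}\bigl(f(h^{-1}x)\bigr)$, where $h|_x\in\mathrm{PSL}_2(\mathbb{Q})$ is the projective transformation with which $h$ coincides near $x$ (defined for almost every $x$). A convex compact $G$-space is a compact convex subset of a locally convex Hausdorff real topological vector space with a $G$-action by affine homeomorphisms. For subgroups $L,M$ of a group $G$, $L$ is co-amenable to $M$ relative to $G$ if every convex compact $G$-space with an $L$-fixed point has an $M$-fixed point; $L$ is co-amenable in $G$ if every convex compact $G$-space with an $L$-fixed point has a $G$-fixed point. **Theorem.** Let $S,S'$ be any sets of primes. Then $\Gamma_S$ and $\Gamma_{S'}$ are subgroups of $H(\mathbb{Q})$, and: 1. If $p\in S'\setminus S$, then $K_p$ is a convex compact $H(\mathbb{Q})$-space that has a $\Gamma_S$-fixed point but no $\Gamma_{S'}$-fixed point. In particular, $\Gamma_S$ is not co-amenable to $\Gamma_{S'}$ relative to $H(\mathbb{Q})$. 2. If $S\subsetneq S'$, then $\Gamma_S$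 is a subgroup of $\Gamma_{S'}$ and is not co-amenable in $\Gamma_{S'}$. -/

import Mathlib

open MeasureTheory Filter Topology Set OnePoint
open scoped MatrixGroups

/-! ## Projective lines -/

/-- The Moebius action of a rational matrix of determinant one on the projective line
`P¹(K) = K ∪ {∞}`, where `K ∪ {∞}` is modelled by `OnePoint K` (the point `x` is `[x : 1]`). -/
noncomputable def mob (K : Type*) [Field K] [Algebra ℚ K] (g : SL(2, ℚ)) (x : OnePoint K) :
    OnePoint K :=
  letI := Classical.decEq K
  Matrix.SpecialLinearGroup.mapGL K g • x

section mob

variable {K : Type*} [Field K] [Algebra ℚ K]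

theorem mob_one (x : OnePoint K) : mob K 1 x = x := by
  simp [mob]

theorem mob_mul (g h : SL(2, ℚ)) (x : OnePoint K) : mob K (g * h) x = mob K g (mob K h x) := by
  simp [mob, mul_smul]

theorem mob_inv_mob (g : SL(2, ℚ)) (x : OnePoint K) : mob K g⁻¹ (mob K g x) = x := by
  rw [← mob_mul, inv_mul_cancel, mob_one]

theorem mob_mob_inv (g : SL(2, ℚ)) (x : OnePoint K) : mob K g (mob K g⁻¹ x) = x := by
  rw [← mob_mul, mul_inv_cancel, mob_one]

theorem mob_coe_eq_coe_iff (g : SL(2, ℚ)) (x y : K) :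
    mob K g (x : OnePoint K) = (y : OnePoint K) ↔
      algebraMap ℚ K (g 1 0) * x + algebraMap ℚ K (g 1 1) ≠ 0 ∧
      y = (algebraMap ℚ K (g 0 0) * x + algebraMap ℚ K (g 0 1)) /
        (algebraMap ℚ K (g 1 0) * x + algebraMap ℚ K (g 1 1)) := by
  have e : ∀ i j, (Matrix.SpecialLinearGroup.mapGL K g) i j = algebraMap ℚ K (g i j) :=
    fun i j => rfl
  let _ := Classical.decEq K
  change Matrix.SpecialLinearGroup.mapGL K g • (x : OnePoint K) = (y : OnePoint K) ↔ _
  rw [OnePoint.smul_some_eq_ite]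
  simp only [e]
  split_ifs with h
  · simp only [OnePoint.infty_ne_coe, false_iff, not_and]
    exact fun h' => absurd h h'
  · rw [OnePoint.coe_eq_coe]
    exact ⟨fun e => ⟨h, e.symm⟩, fun e => e.2.symm⟩

end mob

section continuity

variable {K : Type*} [NontriviallyNormedField K] [DecidableEq K]

open Matrix

theorem continuous_smul_upper (g : GL (Fin 2) K) (hg : g 1 0 = 0) :
    Continuous fun x : OnePoint K => g • x := by
  have hdet := g.det_ne_zero
  rw [det_fin_two] at hdet
  have h0 : g 0 0 ≠ 0 := by rintro h; simp [h, hg] at hdet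
  have h1 : g 1 1 ≠ 0 := by rintro h; simp [h, hg] at hdet
  let e : K ≃ₜ K := (Homeomorph.mulLeft₀ (g 0 0 / g 1 1) (div_ne_zero h0 h1)).trans
    (Homeomorph.addRight (g 0 1 / g 1 1))
  have : (fun x : OnePoint K => g • x) = e.onePointCongr := by
    funext x
    induction x using OnePoint.rec with
    | infty =>
      simp only [OnePoint.smul_infty_eq_ite, hg, if_true]
      rfl
    | coe x =>
      rw [OnePoint.smul_some_eq_ite]
      simp only [hg, zero_mul, zero_add, h1, if_false]
      change _ = ((g 0 0 / g 1 1 * x + g 0 1 / g 1 1 : K) : OnePoint K)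
      rw [OnePoint.coe_eq_coe]
      field_simp
  rw [this]
  exact e.onePointCongr.continuous

/-- The matrix of the inversion `x ↦ 1 / x`. -/
def inversionGL (K : Type*) [Field K] : GL (Fin 2) K :=
  ⟨!![0, 1; 1, 0], !![0, 1; 1, 0], by simp [one_fin_two], by simp [one_fin_two]⟩

variable [ProperSpace K]

theorem continuous_smul_inversion : Continuous fun x : OnePoint K => inversionGL K • x := by
  have hc : ∀ x : K, inversionGL K • (x : OnePoint K) = if x = 0 then ∞ else ((x⁻¹ : K) : OnePoint K) := by
    intro x
    rw [OnePoint.smul_some_eq_ite]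
    simp [inversionGL]
  have hi : inversionGL K • (∞ : OnePoint K) = ((0 : K) : OnePoint K) := by
    rw [OnePoint.smul_infty_eq_ite]
    simp [inversionGL]
  rw [continuous_iff_continuousAt]
  intro x
  induction x using OnePoint.rec with
  | infty =>
    rw [OnePoint.continuousAt_infty', hi]
    have : Tendsto (fun x : K => ((x⁻¹ : K) : OnePoint K)) (coclosedCompact K)
        (𝓝 ((0 : K) : OnePoint K)) := by
      refine (OnePoint.continuous_coe.tendsto (0 : K)).comp ?_
      rw [coclosedCompact_eq_cocompact, ← Metric.cobounded_eq_cocompact]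
      exact tendsto_inv₀_cobounded
    refine this.congr' ?_
    have : ∀ᶠ x : K in coclosedCompact K, x ≠ 0 := by
      rw [coclosedCompact_eq_cocompact]
      exact (isCompact_singleton (x := (0:K))).compl_mem_cocompact
    filter_upwards [this] with x hx
    simp [hc, hx]
  | coe x =>
    rw [OnePoint.continuousAt_coe]
    by_cases hx : x = 0
    · subst hx
      rw [← continuousWithinAt_compl_self]
      have : Tendsto (fun x : K => ((x⁻¹ : K) : OnePoint K)) (𝓝[≠] 0) (𝓝 ∞) := by
        refine OnePoint.tendsto_coe_infty.comp ?_
        rw [coclosedCompact_eq_cocompact, ← Metric.cobounded_eq_cocompact]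
        exact tendsto_inv₀_nhdsNE_zero
      have h0 : inversionGL K • ((0 : K) : OnePoint K) = ∞ := by simp [hc]
      rw [ContinuousWithinAt, Function.comp_apply, h0]
      refine this.congr' ?_
      filter_upwards [self_mem_nhdsWithin] with y hy
      simp only [mem_compl_iff, mem_singleton_iff] at hy
      simp [hc, hy]
    · have : ContinuousAt (fun x : K => ((x⁻¹ : K) : OnePoint K)) x :=
        OnePoint.continuous_coe.continuousAt.comp (continuousAt_inv₀ hx)
      refine this.congr ?_
      filter_upwards [isOpen_ne.mem_nhds hx] with y hy
      have hy' : y ≠ 0 := hy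
      simp [hc, hy']

theorem continuous_smul_onePoint (g : GL (Fin 2) K) : Continuous fun x : OnePoint K => g • x := by
  by_cases hg : g 1 0 = 0
  · exact continuous_smul_upper g hg
  · have hdet := g.det_ne_zero
    let u : GL (Fin 2) K := GeneralLinearGroup.mkOfDetNeZero !![1, g 0 0 / g 1 0; 0, 1] (by simp)
    let v : GL (Fin 2) K := GeneralLinearGroup.mkOfDetNeZero
      !![g 1 0, g 1 1; 0, g 0 1 - g 0 0 * g 1 1 / g 1 0] (by
        rw [det_fin_two] at hdet
        simp only [det_fin_two_of, mul_zero, sub_zero]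
        intro h
        apply hdet
        field_simp at h
        linear_combination - h)
    have : g = u * inversionGL K * v := by
      ext i j
      fin_cases i <;> fin_cases j <;>
        simp [u, v, inversionGL, GeneralLinearGroup.mkOfDetNeZero, Matrix.mul_apply,
          Fin.sum_univ_two] <;> field_simp <;> ring
    have e : (fun x : OnePoint K => g • x) = (fun x => u • x) ∘ (fun x => inversionGL K • x) ∘
        (fun x => v • x) := by
      funext x
      conv_lhs => rw [this]
      simp [mul_smul]
    rw [e]
    refine (continuous_smul_upper u ?_).comp (continuous_smul_inversion.comp
      (continuous_smul_upper v ?_)) <;> simp [u, v, GeneralLinearGroup.mkOfDetNeZero]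

theorem continuous_mob {K : Type*} [NontriviallyNormedField K] [ProperSpace K] [Algebra ℚ K]
    (g : SL(2, ℚ)) : Continuous (mob K g) :=
  letI := Classical.decEq K
  continuous_smul_onePoint _

instance {K : Type*} [NontriviallyNormedField K] [ProperSpace K] :
    SecondCountableTopology (OnePoint K) := by
  classical
  have : ContinuousConstSMul (GL (Fin 2) K) (OnePoint K) := ⟨continuous_smul_onePoint⟩
  let e : OnePoint K ≃ₜ OnePoint K := Homeomorph.smul (inversionGL K)
  have h0 : IsOpenEmbedding ((↑) : K → OnePoint K) := OnePoint.isOpenEmbedding_coe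
  have h1 : IsOpenEmbedding (e ∘ ((↑) : K → OnePoint K)) := e.isOpenEmbedding.comp h0
  let U : Bool → Set (OnePoint K) := fun b =>
    if b then range ((↑) : K → OnePoint K) else range (e ∘ ((↑) : K → OnePoint K))
  have hU : ∀ b, SecondCountableTopology (U b) := by
    rintro (_ | _)
    · exact h1.toIsEmbedding.toHomeomorph.symm.secondCountableTopology
    · exact h0.toIsEmbedding.toHomeomorph.symm.secondCountableTopology
  refine TopologicalSpace.secondCountableTopology_of_countable_cover (U := U) ?_ ?_
  · rintro (_ | _)
    · exact h1.isOpen_range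
    · exact h0.isOpen_range
  · refine eq_univ_of_forall fun x => ?_
    rw [mem_iUnion]
    induction x using OnePoint.rec with
    | infty =>
      refine ⟨false, (0 : K), ?_⟩
      change inversionGL K • ((0 : K) : OnePoint K) = ∞
      rw [OnePoint.smul_some_eq_ite]
      simp [inversionGL]
    | coe x => exact ⟨true, x, rfl⟩

end continuity

/-! ## Groups of piecewise projective homeomorphisms of the line -/

/-- `SL₂(A)` as a subgroup of `SL₂(ℚ)`, for a subring `A` of `ℚ`. -/
def SL2 (A : Subring ℚ) : Subgroup SL(2, ℚ) :=
  (Matrix.SpecialLinearGroup.map A.subtype).range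

/-- The homeomorphism `h` of the line is piecewise-`SL₂(A)` with breakpoints in `B`: outside a
finite set of points of `B`, the line decomposes into intervals on each of which
`h x = (a x + b) / (c x + d)` for some matrix in `SL₂(A)`. (The equality is read in
`ℝ ∪ {∞}`, so it includes `c x + d ≠ 0`; see `mob_coe_eq_coe_iff`.) -/
def IsPiecewiseProjective (A : Subring ℚ) (B : Set ℝ) (h : ℝ ≃ₜ ℝ) : Prop :=
  ∃ F : Finset ℝ, (F : Set ℝ) ⊆ B ∧ ∀ I : Set ℝ, I.OrdConnected → Disjoint I (F : Set ℝ) →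
    ∃ g ∈ SL2 A, ∀ x ∈ I, ((h x : ℝ) : OnePoint ℝ) = mob ℝ g (x : OnePoint ℝ)

/-- `B ∪ {∞}` need only be invariant in the sense that `SL₂(A)` does not move a point of `B` to a
real number outside `B`. -/
def IsProjInvariant (A : Subring ℚ) (B : Set ℝ) : Prop :=
  ∀ g ∈ SL2 A, ∀ x ∈ B, ∀ y : ℝ, mob ℝ g (x : OnePoint ℝ) = (y : OnePoint ℝ) → y ∈ B

section piecewise

variable {A : Subring ℚ} {B : Set ℝ}

theorem IsPiecewiseProjective.one : IsPiecewiseProjective A B 1 :=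
  ⟨∅, by simp, fun I _ _ => ⟨1, one_mem _, fun x _ => by simp [mob_one]⟩⟩

theorem IsPiecewiseProjective.mul (hB : IsProjInvariant A B) {h k : ℝ ≃ₜ ℝ}
    (hh : IsPiecewiseProjective A B h) (hk : IsPiecewiseProjective A B k) :
    IsPiecewiseProjective A B (h * k) := by
  obtain ⟨F, hFB, hF⟩ := hh
  obtain ⟨E, hEB, hE⟩ := hk
  refine ⟨E ∪ F.image k.symm, ?_, ?_⟩
  · intro x hx
    by_cases hxE : x ∈ E
    · exact hEB hxE
    · have hx' : k x ∈ F := by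
        simp only [Finset.coe_union, Finset.coe_image, mem_union, Finset.mem_coe, hxE,
          false_or] at hx
        obtain ⟨y, hy, rfl⟩ := hx
        simpa using hy
      obtain ⟨g, hg, e⟩ := hE {x} ordConnected_singleton (by simpa using hxE)
      refine hB g⁻¹ (inv_mem hg) (k x) (hFB hx') x ?_
      rw [e x rfl, mob_inv_mob]
  · intro I hI hd
    have hd1 : Disjoint I (E : Set ℝ) := hd.mono_right (by simp)
    obtain ⟨g, hg, e⟩ := hE I hI hd1
    obtain ⟨g', hg', e'⟩ := hF (k '' I)
      (hI.isPreconnected.image k k.continuous.continuousOn).ordConnected (by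
        rw [Set.disjoint_left]
        rintro _ ⟨x, hx, rfl⟩ hxF
        refine Set.disjoint_left.1 hd hx ?_
        simp only [Finset.coe_union, Finset.coe_image]
        exact Or.inr ⟨k x, hxF, by simp⟩)
    refine ⟨g' * g, mul_mem hg' hg, fun x hx => ?_⟩
    rw [mob_mul, ← e x hx, ← e' _ ⟨x, hx, rfl⟩]
    rfl

theorem IsPiecewiseProjective.inv (hB : IsProjInvariant A B) {h : ℝ ≃ₜ ℝ}
    (hh : IsPiecewiseProjective A B h) : IsPiecewiseProjective A B h⁻¹ := by
  obtain ⟨F, hFB, hF⟩ := hh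
  refine ⟨F.image h, ?_, ?_⟩
  · intro y hy
    rw [Finset.coe_image] at hy
    obtain ⟨x, hx, rfl⟩ := hy
    have hU : ((F.erase x : Finset ℝ) : Set ℝ)ᶜ ∈ 𝓝 x :=
      (F.erase x).finite_toSet.isClosed.isOpen_compl.mem_nhds (by simp)
    obtain ⟨ε, hε, hball⟩ := Metric.mem_nhds_iff.1 hU
    obtain ⟨g, hg, e⟩ := hF (Ioo x (x + ε)) ordConnected_Ioo (by
      rw [Set.disjoint_left]
      intro z hz hzF
      have : z ∈ Metric.ball x ε := by
        rw [Real.ball_eq_Ioo]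
        exact ⟨by linarith [hz.1], hz.2⟩
      exact hball this (by simpa using ⟨hzF, hz.1.ne'⟩))
    refine hB g hg x (hFB hx) (h x) ?_
    have l1 : Tendsto (fun z : ℝ => ((h z : ℝ) : OnePoint ℝ)) (𝓝[>] x)
        (𝓝 ((h x : ℝ) : OnePoint ℝ)) :=
      ((OnePoint.continuous_coe.comp h.continuous).tendsto x).mono_left nhdsWithin_le_nhds
    have l2 : Tendsto (fun z : ℝ => mob ℝ g (z : OnePoint ℝ)) (𝓝[>] x)
        (𝓝 (mob ℝ g (x : OnePoint ℝ))) :=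
      (((continuous_mob g).comp OnePoint.continuous_coe).tendsto x).mono_left nhdsWithin_le_nhds
    refine tendsto_nhds_unique (l2.congr' ?_) l1
    filter_upwards [Ioo_mem_nhdsGT (show x < x + ε by linarith)] with z hz
    exact (e z hz).symm
  · intro I hI hd
    obtain ⟨g, hg, e⟩ := hF (h.symm '' I)
      (hI.isPreconnected.image h.symm h.symm.continuous.continuousOn).ordConnected (by
        rw [Set.disjoint_left]
        rintro _ ⟨x, hx, rfl⟩ hxF
        refine Set.disjoint_left.1 hd hx ?_
        rw [Finset.coe_image]
        exact ⟨_, hxF, by simp⟩)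
    refine ⟨g⁻¹, inv_mem hg, fun x hx => ?_⟩
    have := e _ ⟨x, hx, rfl⟩
    rw [Homeomorph.apply_symm_apply] at this
    rw [this, mob_inv_mob]
    rfl

end piecewise

/-- The group of piecewise-`SL₂(A)` homeomorphisms of the line with breakpoints in `B`. -/
def piecewiseGroup (A : Subring ℚ) (B : Set ℝ) (hB : IsProjInvariant A B) :
    Subgroup (ℝ ≃ₜ ℝ) where
  carrier := {h | IsPiecewiseProjective A B h}
  one_mem' := .one
  mul_mem' := fun hh hk => hh.mul hB hk
  inv_mem' := fun hh => hh.inv hB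

/-- The real fixed points of the hyperbolic elements (`|trace| > 2`) of `SL₂(A)`. -/
def hyperbolicFixedPoints (A : Subring ℚ) : Set ℝ :=
  {x | ∃ g ∈ SL2 A, 2 < |(g : Matrix (Fin 2) (Fin 2) ℚ).trace| ∧
    mob ℝ g (x : OnePoint ℝ) = (x : OnePoint ℝ)}

theorem isProjInvariant_hyperbolicFixedPoints (A : Subring ℚ) :
    IsProjInvariant A (hyperbolicFixedPoints A) := by
  rintro g hg x ⟨k, hk, ht, hx⟩ y hy
  refine ⟨g * k * g⁻¹, mul_mem (mul_mem hg hk) (inv_mem hg), ?_, ?_⟩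
  · have : ((g * k * g⁻¹ : SL(2, ℚ)) : Matrix (Fin 2) (Fin 2) ℚ).trace
        = (k : Matrix (Fin 2) (Fin 2) ℚ).trace := by
      rw [Matrix.SpecialLinearGroup.coe_mul, Matrix.trace_mul_comm,
        ← Matrix.SpecialLinearGroup.coe_mul, inv_mul_cancel_left]
    rwa [this]
  · rw [mob_mul, mob_mul, ← hy, mob_inv_mob, hx]

/-- The group `H(A)`: the breakpoints are fixed points of hyperbolic elements of `SL₂(A)`. -/
def groupH (A : Subring ℚ) : Subgroup (ℝ ≃ₜ ℝ) :=
  piecewiseGroup A (hyperbolicFixedPoints A) (isProjInvariant_hyperbolicFixedPoints A)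

/-- The group `H(ℚ)`. -/
abbrev HQ : Subgroup (ℝ ≃ₜ ℝ) := groupH ⊤

/-- The ring `ℤ[1/S]`, as a subring of `ℚ`. -/
def ZInv (S : Set ℕ) : Subring ℚ :=
  Subring.closure {x | ∃ q ∈ S, x = (q : ℚ)⁻¹}

/-- The group `Γ_S` of all piecewise-`SL₂(ℤ[1/S])` homeomorphisms of the line. -/
def Gamma (S : Set ℕ) : Subgroup (ℝ ≃ₜ ℝ) :=
  piecewiseGroup (ZInv S) univ fun _ _ _ _ _ _ => mem_univ _

/-! ## The projective part -/

/-- The action of homeomorphisms of the line on `P¹(ℝ) = ℝ ∪ {∞}`, fixing `∞`. -/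
def extendP1 (h : ℝ ≃ₜ ℝ) : OnePoint ℝ ≃ₜ OnePoint ℝ := h.onePointCongr

@[simp] theorem extendP1_coe (h : ℝ ≃ₜ ℝ) (x : ℝ) :
    extendP1 h (x : OnePoint ℝ) = ((h x : ℝ) : OnePoint ℝ) := rfl

/-- `h` coincides near `x` with the projective transformation `g`. -/
def IsProjNear (h : ℝ ≃ₜ ℝ) (g : SL(2, ℚ)) (x : OnePoint ℝ) : Prop :=
  ∀ᶠ y in 𝓝 x, extendP1 h y = mob ℝ g y

open Classical in
/-- A matrix representative of the projective part `h|ₓ` of `h` at `x`: a matrix `g` such that `h`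
coincides with `g` near `x`. It is unique up to sign, and the sign acts trivially on projective
lines. At the points where there is no such matrix (a null set for `h ∈ H(ℚ)`), the value is
irrelevant, and set to `1`. -/
noncomputable def projPart (h : ℝ ≃ₜ ℝ) (x : OnePoint ℝ) : SL(2, ℚ) :=
  if hx : ∃ g, IsProjNear h g x then hx.choose else 1

theorem isProjNear_projPart {h : ℝ ≃ₜ ℝ} {g : SL(2, ℚ)} {x : OnePoint ℝ}
    (hx : IsProjNear h g x) : IsProjNear h (projPart h x) x := by
  have hx' : ∃ g, IsProjNear h g x := ⟨g, hx⟩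
  rw [projPart, dif_pos hx']
  exact hx'.choose_spec

theorem mob_eq_self_of_scalar {K : Type*} [Field K] [Algebra ℚ K] {g : SL(2, ℚ)}
    (h10 : g 1 0 = 0) (h01 : g 0 1 = 0) (hd : g 0 0 = g 1 1) (z : OnePoint K) :
    mob K g z = z := by
  have e : ∀ i j, (Matrix.SpecialLinearGroup.mapGL K g) i j = algebraMap ℚ K (g i j) :=
    fun i j => rfl
  have hdet := g.det_coe
  rw [Matrix.det_fin_two, h10, hd] at hdet
  have h11 : g 1 1 ≠ 0 := by
    rintro h
    simp [h] at hdet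
  let _ := Classical.decEq K
  change Matrix.SpecialLinearGroup.mapGL K g • z = z
  induction z using OnePoint.rec with
  | infty => rw [OnePoint.smul_infty_eq_ite]; simp [e, h10]
  | coe x =>
    have h11' : algebraMap ℚ K (g 1 1) ≠ 0 := by
      rw [Ne, map_eq_zero]
      exact h11
    rw [OnePoint.smul_some_eq_ite]
    simp only [e, h10, h01, hd, map_zero, zero_mul, zero_add, add_zero, if_neg h11']
    rw [OnePoint.coe_eq_coe]
    field_simp

/-- The projective part is unique up to an element that acts trivially. -/
theorem IsProjNear.mob_eq {h : ℝ ≃ₜ ℝ} {g k : SL(2, ℚ)} {x : ℝ}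
    (hg : IsProjNear h g (x : OnePoint ℝ)) (hk : IsProjNear h k (x : OnePoint ℝ))
    {K : Type*} [Field K] [Algebra ℚ K] (z : OnePoint K) : mob K g z = mob K k z := by
  have h1 : ∀ᶠ y : ℝ in 𝓝 x, mob ℝ (k⁻¹ * g) (y : OnePoint ℝ) = (y : OnePoint ℝ) := by
    have : ∀ᶠ y in 𝓝 (x : OnePoint ℝ), mob ℝ (k⁻¹ * g) y = y := by
      filter_upwards [hg, hk] with y h1 h2
      rw [mob_mul, ← h1, h2, mob_inv_mob]
    exact (OnePoint.continuous_coe.tendsto x).eventually this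
  have hinf : {y : ℝ | mob ℝ (k⁻¹ * g) (y : OnePoint ℝ) = (y : OnePoint ℝ)}.Infinite :=
    infinite_of_mem_nhds x h1
  have hpoly : (Matrix.SpecialLinearGroup.mapGL ℝ (k⁻¹ * g)).fixpointPolynomial = 0 := by
    refine Polynomial.eq_zero_of_infinite_isRoot _ (hinf.mono fun y hy => ?_)
    have := (Matrix.GeneralLinearGroup.fixpointPolynomial_aeval_eq_zero_iff
      (g := Matrix.SpecialLinearGroup.mapGL ℝ (k⁻¹ * g)) (c := y)).2 (by
        have hy' : mob ℝ (k⁻¹ * g) (y : OnePoint ℝ) = (y : OnePoint ℝ) := hy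
        unfold mob at hy'
        convert hy')
    simpa using this
  rw [Matrix.GeneralLinearGroup.fixpointPolynomial_eq_zero_iff] at hpoly
  obtain ⟨r, hr⟩ := hpoly
  have e : ∀ i j, (algebraMap ℚ ℝ ((k⁻¹ * g) i j)) = Matrix.scalar (Fin 2) r i j := fun i j => by
    rw [hr]; rfl
  have hs := mob_eq_self_of_scalar (K := K) (g := k⁻¹ * g)
    (by simpa using e 1 0) (by simpa using e 0 1)
    ((algebraMap ℚ ℝ).injective (by rw [e, e]; simp)) z
  rw [mob_mul] at hs
  conv_rhs => rw [← hs]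
  rw [mob_mob_inv]

theorem IsProjNear.mul {h k : ℝ ≃ₜ ℝ} {g g' : SL(2, ℚ)} {x : OnePoint ℝ}
    (hh : IsProjNear h g (extendP1 k x)) (hk : IsProjNear k g' x) :
    IsProjNear (h * k) (g * g') x := by
  have : ∀ᶠ y in 𝓝 x, extendP1 h (extendP1 k y) = mob ℝ g (extendP1 k y) :=
    (extendP1 k).continuous.continuousAt.eventually hh
  filter_upwards [this, hk] with y h1 h2
  rw [mob_mul, ← h2, ← h1]
  induction y using OnePoint.rec <;> rfl

theorem IsPiecewiseProjective.exists_isProjNear {A : Subring ℚ} {B : Set ℝ} {h : ℝ ≃ₜ ℝ}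
    (hh : IsPiecewiseProjective A B h) :
    ∃ F : Finset ℝ, ∀ x : ℝ, x ∉ F → ∃ g, IsProjNear h g (x : OnePoint ℝ) := by
  obtain ⟨F, -, hF⟩ := hh
  refine ⟨F, fun x hx => ?_⟩
  have hU : (F : Set ℝ)ᶜ ∈ 𝓝 x := F.finite_toSet.isClosed.isOpen_compl.mem_nhds (by simpa)
  obtain ⟨ε, hε, hball⟩ := Metric.mem_nhds_iff.1 hU
  obtain ⟨g, -, e⟩ := hF (Metric.ball x ε) (by rw [Real.ball_eq_Ioo]; exact ordConnected_Ioo)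
    (Set.disjoint_left.2 fun z hz hzF => hball hz hzF)
  refine ⟨g, ?_⟩
  rw [IsProjNear, OnePoint.nhds_coe_eq, eventually_map]
  filter_upwards [Metric.ball_mem_nhds x hε] with y hy using e y hy

/-! ## Measures -/

/-- The Borel structure of a one-point compactification. -/
instance {X : Type*} [TopologicalSpace X] : MeasurableSpace (OnePoint X) := borel _

instance {X : Type*} [TopologicalSpace X] : BorelSpace (OnePoint X) := ⟨rfl⟩

/-- Lebesgue measure on `P¹(ℝ) = ℝ ∪ {∞}`, the point `∞` being a null set. Its null sets are the
usual null sets of the projective line. -/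
noncomputable def volP1 : Measure (OnePoint ℝ) := Measure.map ((↑) : ℝ → OnePoint ℝ) volume

theorem measurableEmbedding_coeP1 : MeasurableEmbedding ((↑) : ℝ → OnePoint ℝ) :=
  OnePoint.isOpenEmbedding_coe.measurableEmbedding

theorem ae_volP1_iff {P : OnePoint ℝ → Prop} :
    (∀ᵐ x ∂volP1, P x) ↔ ∀ᵐ x : ℝ, P (x : OnePoint ℝ) :=
  measurableEmbedding_coeP1.ae_map_iff

theorem IsPiecewiseProjective.ae_exists_isProjNear {A : Subring ℚ} {B : Set ℝ} {h : ℝ ≃ₜ ℝ}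
    (hh : IsPiecewiseProjective A B h) : ∀ᵐ x : ℝ, ∃ g, IsProjNear h g (x : OnePoint ℝ) := by
  obtain ⟨F, hF⟩ := hh.exists_isProjNear
  filter_upwards [F.countable_toSet.ae_notMem volume] with x hx using hF x hx

/-- Piecewise projective homeomorphisms preserve null sets. -/
theorem IsPiecewiseProjective.volume_image_eq_zero {A : Subring ℚ} {B : Set ℝ} {h : ℝ ≃ₜ ℝ}
    (hh : IsPiecewiseProjective A B h) {s : Set ℝ} (hs : volume s = 0) :
    volume (h '' s) = 0 := by
  obtain ⟨F, hF⟩ := hh.exists_isProjNear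
  have h1 : volume (h '' (s \ F)) = 0 := by
    refine addHaar_image_eq_zero_of_differentiableOn_of_addHaar_eq_zero volume ?_
      (measure_mono_null sdiff_subset hs)
    intro x hx
    obtain ⟨g, hg⟩ := hF x hx.2
    have hg' : ∀ᶠ y : ℝ in 𝓝 x, ((h y : ℝ) : OnePoint ℝ) = mob ℝ g (y : OnePoint ℝ) :=
      (OnePoint.continuous_coe.tendsto x).eventually hg
    have hne := ((mob_coe_eq_coe_iff _ _ _).1 hg'.self_of_nhds.symm).1
    have hd : DifferentiableAt ℝ (fun y : ℝ => (algebraMap ℚ ℝ (g 0 0) * y +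
        algebraMap ℚ ℝ (g 0 1)) / (algebraMap ℚ ℝ (g 1 0) * y + algebraMap ℚ ℝ (g 1 1))) x := by
      fun_prop (disch := exact hne)
    refine (hd.congr_of_eventuallyEq ?_).differentiableWithinAt
    filter_upwards [hg'] with y hy using ((mob_coe_eq_coe_iff _ _ _).1 hy.symm).2
  have h2 : volume (h '' (F : Set ℝ)) = 0 := (F.finite_toSet.image h).measure_zero _
  refine measure_mono_null ?_ (measure_union_null h1 h2)
  rw [← image_union]
  exact image_mono (by simp)

theorem quasiMeasurePreserving_extendP1 (h : HQ) :
    Measure.QuasiMeasurePreserving (extendP1 (h : ℝ ≃ₜ ℝ)) volP1 volP1 := by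
  refine ⟨(extendP1 (h : ℝ ≃ₜ ℝ)).continuous.measurable, ?_⟩
  refine Measure.AbsolutelyContinuous.mk fun s hs h0 => ?_
  rw [volP1, measurableEmbedding_coeP1.map_apply] at h0
  rw [Measure.map_apply (extendP1 (h : ℝ ≃ₜ ℝ)).continuous.measurable hs, volP1,
    measurableEmbedding_coeP1.map_apply]
  have := IsPiecewiseProjective.volume_image_eq_zero (h := ((h⁻¹ : HQ) : ℝ ≃ₜ ℝ)) (h⁻¹ : HQ).2 h0
  refine measure_mono_null ?_ this
  intro x hx
  exact ⟨(h : ℝ ≃ₜ ℝ) x, hx, (h : ℝ ≃ₜ ℝ).symm_apply_apply x⟩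

/-! ## Measurable maps from the real to the space of measures on the `p`-adic projective line -/

/-- `Prob(P¹(ℚ_p))`, with the weak-* topology. -/
abbrev ProbP1 (p : ℕ) [Fact p.Prime] := ProbabilityMeasure (OnePoint ℚ_[p])

/-- The action of a rational matrix on `Prob(P¹(ℚ_p))`, by push-forward. -/
noncomputable def push (p : ℕ) [Fact p.Prime] (g : SL(2, ℚ)) (ν : ProbP1 p) : ProbP1 p :=
  ν.map (f := mob ℚ_[p] g) (continuous_mob g).aemeasurable

section push

variable {p : ℕ} [Fact p.Prime]

theorem continuous_push (g : SL(2, ℚ)) : Continuous (push p g) :=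
  ProbabilityMeasure.continuous_map (continuous_mob g)

theorem push_congr {g k : SL(2, ℚ)} (h : ∀ z : OnePoint ℚ_[p], mob ℚ_[p] g z = mob ℚ_[p] k z)
    (ν : ProbP1 p) : push p g ν = push p k ν := by
  have : mob ℚ_[p] g = mob ℚ_[p] k := funext h
  simp only [push, this]

theorem push_one (ν : ProbP1 p) : push p 1 ν = ν := by
  apply Subtype.ext
  have : mob ℚ_[p] 1 = id := funext mob_one
  change Measure.map (mob ℚ_[p] 1) (ν : Measure _) = ν
  rw [this, Measure.map_id]

theorem push_mul (g k : SL(2, ℚ)) (ν : ProbP1 p) : push p (g * k) ν = push p g (push p k ν) := by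
  apply Subtype.ext
  have : mob ℚ_[p] (g * k) = mob ℚ_[p] g ∘ mob ℚ_[p] k := funext (mob_mul g k)
  change Measure.map (mob ℚ_[p] (g * k)) (ν : Measure _) =
    Measure.map (mob ℚ_[p] g) (Measure.map (mob ℚ_[p] k) (ν : Measure _))
  rw [this, Measure.map_map (continuous_mob g).measurable (continuous_mob k).measurable]

end push

/-- The space of measurable maps `P¹(ℝ) → Prob(P¹(ℚ_p))`, where two maps are identified when they
agree outside a null set. -/
def MapSpace (p : ℕ) [Fact p.Prime] : Type := OnePoint ℝ →ₘ[volP1] ProbP1 p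

section MapSpace

variable {p : ℕ} [Fact p.Prime]

noncomputable instance : CoeFun (MapSpace p) fun _ => OnePoint ℝ → ProbP1 p :=
  ⟨fun f => AEEqFun.cast (α := OnePoint ℝ) (β := ProbP1 p) (μ := volP1) f⟩

theorem MapSpace.aestronglyMeasurable (f : MapSpace p) : AEStronglyMeasurable f volP1 :=
  AEEqFun.aestronglyMeasurable (α := OnePoint ℝ) (β := ProbP1 p) (μ := volP1) f

theorem MapSpace.ext {f f' : MapSpace p} (h : f =ᵐ[volP1] f') : f = f' :=
  AEEqFun.ext (α := OnePoint ℝ) (β := ProbP1 p) (μ := volP1) h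

theorem aestronglyMeasurable_push_projPart (h : HQ) (f : MapSpace p) :
    AEStronglyMeasurable (fun x => push p (projPart h x) (f x)) volP1 := by
  let s : SL(2, ℚ) → Set (OnePoint ℝ) := fun g => {x | IsProjNear h g x}
  have hs : ∀ g, MeasurableSet (s g) := fun g => isOpen_setOfPred_eventually_nhds.measurableSet
  have hcov : volP1.restrict (⋃ g, s g) = volP1 := by
    refine Measure.restrict_eq_self_of_ae_mem ?_
    rw [ae_volP1_iff]
    filter_upwards [IsPiecewiseProjective.ae_exists_isProjNear h.2] with x hx
    simpa [s] using hx
  have hc : Countable (Matrix (Fin 2) (Fin 2) ℚ) :=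
    inferInstanceAs (Countable (Fin 2 → Fin 2 → ℚ))
  have : Countable SL(2, ℚ) := Subtype.countable
  suffices H : AEStronglyMeasurable (fun x => push p (projPart h x) (f x))
      (volP1.restrict (⋃ g, s g)) by rwa [hcov] at H
  refine aestronglyMeasurable_iUnion_iff.2 fun g => ?_
  have hg : AEStronglyMeasurable (fun x => push p g (f x)) (volP1.restrict (s g)) :=
    (continuous_push g).comp_aestronglyMeasurable f.aestronglyMeasurable.restrict
  refine hg.congr ?_
  rw [EventuallyEq, ae_restrict_iff' (hs g), ae_volP1_iff]
  refine ae_of_all _ fun x hx => ?_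
  exact push_congr (fun z => IsProjNear.mob_eq hx (isProjNear_projPart hx) z) _

/-- The function `x ↦ h|_{h⁻¹ x} (f (h⁻¹ x))`. -/
noncomputable def actFun (h : HQ) (f : MapSpace p) (x : OnePoint ℝ) : ProbP1 p :=
  push p (projPart h (extendP1 (h⁻¹ : HQ) x)) (f (extendP1 (h⁻¹ : HQ) x))

theorem aestronglyMeasurable_actFun (h : HQ) (f : MapSpace p) :
    AEStronglyMeasurable (actFun h f) volP1 :=
  (aestronglyMeasurable_push_projPart h f).comp_quasiMeasurePreserving
    (quasiMeasurePreserving_extendP1 h⁻¹)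

noncomputable instance : SMul HQ (MapSpace p) :=
  ⟨fun h f => AEEqFun.mk (actFun h f) (aestronglyMeasurable_actFun h f)⟩

theorem coeFn_smul (h : HQ) (f : MapSpace p) : (h • f : MapSpace p) =ᵐ[volP1] actFun h f :=
  AEEqFun.coeFn_mk _ _

/-- The action `(h.f)(x) = h|_{h⁻¹ x} (f (h⁻¹ x))` of `H(ℚ)` on measurable maps. -/
noncomputable instance : MulAction HQ (MapSpace p) where
  one_smul f := by
    refine MapSpace.ext ((coeFn_smul 1 f).trans ?_)
    rw [EventuallyEq, ae_volP1_iff]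
    refine ae_of_all _ fun x => ?_
    have h1 : IsProjNear ((1 : HQ) : ℝ ≃ₜ ℝ) 1 (x : OnePoint ℝ) := by
      refine Eventually.of_forall fun y => ?_
      rw [mob_one]
      induction y using OnePoint.rec <;> rfl
    have h2 : extendP1 ((1⁻¹ : HQ) : ℝ ≃ₜ ℝ) (x : OnePoint ℝ) = x := rfl
    rw [actFun, h2, push_congr (fun z => IsProjNear.mob_eq (isProjNear_projPart h1) h1 z),
      push_one]
  mul_smul h k f := by
    have e1 : ∀ᵐ x ∂volP1, (k • f : MapSpace p) (extendP1 (h⁻¹ : HQ) x) =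
        actFun k f (extendP1 (h⁻¹ : HQ) x) :=
      (quasiMeasurePreserving_extendP1 h⁻¹).ae (coeFn_smul k f)
    have e2 : ∀ᵐ x ∂volP1, ∃ g, IsProjNear h g (extendP1 (h⁻¹ : HQ) x) :=
      (quasiMeasurePreserving_extendP1 h⁻¹).ae (p := fun x => ∃ g, IsProjNear h g x)
        (ae_volP1_iff.2 (IsPiecewiseProjective.ae_exists_isProjNear h.2))
    have e3 : ∀ᵐ x ∂volP1, ∃ g, IsProjNear k g (extendP1 ((h * k)⁻¹ : HQ) x) :=
      (quasiMeasurePreserving_extendP1 (h * k)⁻¹).ae (p := fun x => ∃ g, IsProjNear k g x)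
        (ae_volP1_iff.2 (IsPiecewiseProjective.ae_exists_isProjNear k.2))
    refine MapSpace.ext ((coeFn_smul (h * k) f).trans
      (EventuallyEq.trans ?_ (coeFn_smul h (k • f)).symm))
    rw [EventuallyEq]
    rw [ae_volP1_iff] at e1 e2 e3 ⊢
    filter_upwards [e1, e2, e3] with x h1 ⟨g, hg⟩ ⟨g', hg'⟩
    set z : ℝ := ((h * k)⁻¹ : HQ).1 x with hz
    have hx1 : extendP1 ((h * k)⁻¹ : HQ) (x : OnePoint ℝ) = (z : OnePoint ℝ) := rfl
    have hx2 : extendP1 (h⁻¹ : HQ) (x : OnePoint ℝ) = extendP1 k (z : OnePoint ℝ) := by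
      rw [extendP1_coe, extendP1_coe, OnePoint.coe_eq_coe, hz]
      simp
    have hx3 : extendP1 (k⁻¹ : HQ) (extendP1 (h⁻¹ : HQ) (x : OnePoint ℝ)) = (z : OnePoint ℝ) := by
      rw [extendP1_coe, extendP1_coe, OnePoint.coe_eq_coe, hz]
      simp
    have hn := (isProjNear_projPart hg)
    rw [hx1] at hg'
    have hm := isProjNear_projPart hg'
    rw [hx2] at hn
    have hmul := hn.mul hm
    rw [actFun, actFun, h1, actFun, hx3, hx2, hx1, ← push_mul]
    exact push_congr (fun w => IsProjNear.mob_eq (isProjNear_projPart hmul) hmul w) _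

end MapSpace

/-! ## Realisation in the weak-* dual of `L¹(P¹(ℝ), C(P¹(ℚ_p)))` -/

section pairing

variable {p : ℕ} [Fact p.Prime]

/-- The Banach space `L¹(P¹(ℝ), C(P¹(ℚ_p)))`. -/
noncomputable abbrev L1C (p : ℕ) [Fact p.Prime] := Lp C(OnePoint ℚ_[p], ℝ) 1 volP1

theorem integrable_continuousMap (ν : ProbP1 p) (c : C(OnePoint ℚ_[p], ℝ)) :
    Integrable c (ν : Measure (OnePoint ℚ_[p])) :=
  (BoundedContinuousFunction.mkOfCompact c).integrable _

theorem norm_integral_continuousMap_le (ν : ProbP1 p) (c : C(OnePoint ℚ_[p], ℝ)) :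
    ‖∫ y, c y ∂(ν : Measure (OnePoint ℚ_[p]))‖ ≤ ‖c‖ := by
  refine (norm_integral_le_of_norm_le_const (C := ‖c‖)
    (ae_of_all _ fun y => c.norm_coe_le_norm y)).trans ?_
  simp

theorem continuous_integral_pair :
    Continuous fun q : ProbP1 p × C(OnePoint ℚ_[p], ℝ) =>
      ∫ y, q.2 y ∂(q.1 : Measure (OnePoint ℚ_[p])) := by
  rw [continuous_iff_continuousAt]
  rintro ⟨ν, c⟩
  have h1 : Tendsto (fun q : ProbP1 p × C(OnePoint ℚ_[p], ℝ) =>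
      ∫ y, c y ∂(q.1 : Measure (OnePoint ℚ_[p]))) (𝓝 (ν, c))
      (𝓝 (∫ y, c y ∂(ν : Measure (OnePoint ℚ_[p])))) :=
    ((ProbabilityMeasure.continuous_integral_continuousMap c).comp continuous_fst).tendsto (ν, c)
  have h2 : Tendsto (fun q : ProbP1 p × C(OnePoint ℚ_[p], ℝ) =>
      ∫ y, (q.2 - c) y ∂(q.1 : Measure (OnePoint ℚ_[p]))) (𝓝 (ν, c)) (𝓝 0) := by
    refine squeeze_zero_norm (fun q => norm_integral_continuousMap_le q.1 (q.2 - c)) ?_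
    have : Continuous fun q : ProbP1 p × C(OnePoint ℚ_[p], ℝ) => ‖q.2 - c‖ := by fun_prop
    simpa using this.tendsto (ν, c)
  have h3 := h1.add h2
  rw [add_zero] at h3
  refine h3.congr fun q => ?_
  rw [← integral_add (integrable_continuousMap _ _) (integrable_continuousMap _ _)]
  simp

theorem integrable_pairing (f : MapSpace p) (φ : L1C p) :
    Integrable (fun x => ∫ y, φ x y ∂(f x : Measure (OnePoint ℚ_[p]))) volP1 := by
  refine (L1.integrable_coeFn φ).mono ?_
    (ae_of_all _ fun x => norm_integral_continuousMap_le (f x) (φ x))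
  exact continuous_integral_pair.comp_aestronglyMeasurable
    (f.aestronglyMeasurable.prodMk (Lp.aestronglyMeasurable φ))

/-- A measurable map `f : P¹(ℝ) → Prob(P¹(ℚ_p))`, viewed as the functional
`φ ↦ ∫ (∫ φ(x)(y) d f(x)(y)) dx` in the weak-* dual of `L¹(P¹(ℝ), C(P¹(ℚ_p)))`. -/
noncomputable def pairing (p : ℕ) [Fact p.Prime] (f : MapSpace p) : WeakDual ℝ (L1C p) :=
  StrongDual.toWeakDual (LinearMap.mkContinuous
    { toFun := fun φ => ∫ x, ∫ y, φ x y ∂(f x : Measure (OnePoint ℚ_[p])) ∂volP1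
      map_add' := fun φ ψ => by
        rw [← integral_add (integrable_pairing f φ) (integrable_pairing f ψ)]
        refine integral_congr_ae ?_
        filter_upwards [Lp.coeFn_add φ ψ] with x hx
        rw [hx, ← integral_add (integrable_continuousMap _ _) (integrable_continuousMap _ _)]
        rfl
      map_smul' := fun r φ => by
        rw [RingHom.id_apply, smul_eq_mul, ← integral_const_mul]
        refine integral_congr_ae ?_
        filter_upwards [Lp.coeFn_smul r φ] with x hx
        rw [hx, ← integral_const_mul]
        rfl } 1 fun φ => by
      rw [one_mul, L1.norm_eq_integral_norm]
      exact norm_integral_le_of_norm_le (L1.integrable_coeFn φ).norm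
        (ae_of_all _ fun x => norm_integral_continuousMap_le (f x) (φ x)))

theorem pairing_apply (f : MapSpace p) (φ : L1C p) :
    pairing p f φ = ∫ x, ∫ y, φ x y ∂(f x : Measure (OnePoint ℚ_[p])) ∂volP1 := rfl

end pairing

instance {E : Type*} [AddCommGroup E] [Module ℝ E] [TopologicalSpace E] :
    LocallyConvexSpace ℝ (WeakDual ℝ E) :=
  inferInstanceAs (LocallyConvexSpace ℝ (WeakBilin (topDualPairing ℝ E)))

/-! ## Convex compact spaces and co-amenability -/

/-- The `G`-set `X` is a convex compact `G`-space: it is identified by `ι` with a compact convex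
subset of a locally convex Hausdorff topological vector space `E`, and `G` acts on it by affine
homeomorphisms. -/
structure IsConvexCompactSpace (G X E : Type*) [Group G] [MulAction G X] [AddCommGroup E]
    [Module ℝ E] [TopologicalSpace E] [IsTopologicalAddGroup E] [ContinuousSMul ℝ E]
    [LocallyConvexSpace ℝ E] [T2Space E] (ι : X → E) : Prop where
  injective : Function.Injective ι
  isCompact : IsCompact (range ι)
  convex : Convex ℝ (range ι)
  continuous_smul : ∀ g : G,
    Continuous[TopologicalSpace.induced ι inferInstance, TopologicalSpace.induced ι inferInstance]
      fun x : X => g • x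
  affine_smul : ∀ (g : G) (x y z : X) (a b : ℝ), 0 ≤ a → 0 ≤ b → a + b = 1 →
    ι z = a • ι x + b • ι y → ι (g • z) = a • ι (g • x) + b • ι (g • y)

/-- The point `x` is fixed by the subgroup `L`. -/
def IsFixedPoint {G X : Type*} [Group G] [MulAction G X] (L : Subgroup G) (x : X) : Prop :=
  ∀ g ∈ L, g • x = x

/-- The subgroup `L` is co-amenable to the subgroup `M` relative to `G`: every convex compact
`G`-space with an `L`-fixed point has an `M`-fixed point. -/
def IsCoamenableTo.{u} {G : Type u} [Group G] (L M : Subgroup G) : Prop :=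
  ∀ (X E : Type u) [MulAction G X] [AddCommGroup E] [Module ℝ E] [TopologicalSpace E]
    [IsTopologicalAddGroup E] [ContinuousSMul ℝ E] [LocallyConvexSpace ℝ E] [T2Space E]
    (ι : X → E), IsConvexCompactSpace G X E ι →
    (∃ x : X, IsFixedPoint L x) → ∃ x : X, IsFixedPoint M x

/-- The subgroup `L` is co-amenable in `G`: every convex compact `G`-space with an `L`-fixed point
has a `G`-fixed point. -/
def IsCoamenable.{u} {G : Type u} [Group G] (L : Subgroup G) : Prop :=
  ∀ (X E : Type u) [MulAction G X] [AddCommGroup E] [Module ℝ E] [TopologicalSpace E]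
    [IsTopologicalAddGroup E] [ContinuousSMul ℝ E] [LocallyConvexSpace ℝ E] [T2Space E]
    (ι : X → E), IsConvexCompactSpace G X E ι →
    (∃ x : X, IsFixedPoint L x) → ∃ x : X, ∀ g : G, g • x = x

/-!
The spaces `K_p` tell the groups `Γ_S` apart: `Γ_S` has a fixed point in `K_p` exactly when `p ∉ S`.

*`K_p` is a convex compact space.* For a positive integrable density `w`, the functions `w • ψ` with
`ψ` continuous on `P¹(ℝ) × P¹(ℚ_p)` are dense in `L¹(P¹(ℝ), C(P¹(ℚ_p)))`. On them, a functional
coming from `K_p` is positive and has prescribed values on the functions of the real variable.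
Conversely, a functional with these two properties is integration against a measure on the compact
product (Riesz-Markov-Kakutani) whose projection to `P¹(ℝ)` is `w dx`, and disintegrating this
measure over `P¹(ℝ)` recovers a measurable map (`mem_range_pairing_iff`). Since the two conditions
are weak-* closed and convex, Banach-Alaoglu gives compactness, and convexity is immediate. Each
element of `H(ℚ)` acts by the transpose of a map on `L¹` (`exists_adjoint`), so it acts affinely and
continuously.

*If `p ∉ S`, there is a `Γ_S`-fixed point.* The matrices in `SL₂(ℤ[1/S])` have `p`-integral entries,
so they act on `ℤ_p²` by automorphisms and preserve its Haar measure; the image of this measure in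
`P¹(ℚ_p)` is invariant (`exists_invariant_probP1`), and the constant map at it is fixed.

*If `p ∈ S`, there is none.* The translations by `p⁻ⁿ` belong to `Γ_S`. They tend to the identity on
the line, but they push all of `P¹(ℚ_p)` to `∞`. Hence a fixed point is `δ_∞` almost everywhere
(`ae_eq_dirac_infty`). But `Γ_S` contains a homeomorphism that agrees on an interval with
`x ↦ 3 - 1 / x`, which does not fix `∞` (`hyperbolicBump`).

The inclusion of `Γ_S` in `H(ℚ)` holds because the matrices on the two sides of a breakpoint agree
there, so that a true breakpoint is fixed by a non-trivial element of `SL₂(ℚ)`; such an element is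
hyperbolic, or parabolic with a rational fixed point, and every rational number is also fixed by a
hyperbolic element (`mem_hyperbolicFixedPoints_of_mob_eq`).
-/

/-! ### Piecewise projective homeomorphisms -/

theorem mem_SL2_iff {A : Subring ℚ} {g : SL(2, ℚ)} : g ∈ SL2 A ↔ ∀ i j, g i j ∈ A := by
  constructor
  · rintro ⟨k, rfl⟩ i j
    exact (k i j).2
  · intro h
    refine ⟨⟨Matrix.of fun i j => ⟨g i j, h i j⟩, ?_⟩, ?_⟩
    · apply Subtype.ext
      have := g.det_coe
      rw [Matrix.det_fin_two] at this
      simpa [Matrix.det_fin_two] using this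
    · ext i j
      rfl

theorem SL2_mono {A A' : Subring ℚ} (h : A ≤ A') : SL2 A ≤ SL2 A' := fun _ hg =>
  mem_SL2_iff.2 fun i j => h (mem_SL2_iff.1 hg i j)

theorem IsPiecewiseProjective.mono {A A' : Subring ℚ} {B : Set ℝ} {h : ℝ ≃ₜ ℝ} (hA : A ≤ A')
    (hh : IsPiecewiseProjective A B h) : IsPiecewiseProjective A' B h := by
  obtain ⟨F, hFB, hF⟩ := hh
  refine ⟨F, hFB, fun I hI hd => ?_⟩
  obtain ⟨g, hg, e⟩ := hF I hI hd
  exact ⟨g, SL2_mono hA hg, e⟩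

theorem Gamma_mono {S S' : Set ℕ} (h : S ⊆ S') : Gamma S ≤ Gamma S' := fun _ hh =>
  IsPiecewiseProjective.mono
    (Subring.closure_mono (by rintro _ ⟨q, hq, e⟩; exact ⟨q, h hq, e⟩)) hh

theorem IsProjNear.apply_eq {h : ℝ ≃ₜ ℝ} {g : SL(2, ℚ)} {x : ℝ}
    (hx : IsProjNear h g (x : OnePoint ℝ)) : ((h x : ℝ) : OnePoint ℝ) = mob ℝ g (x : OnePoint ℝ) :=
  hx.self_of_nhds

/-- It suffices to know the matrix near each point: along an interval without breakpoints it is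
locally constant up to sign, so that one matrix serves for the interval. -/
theorem isPiecewiseProjective_top_of_isProjNear {B : Set ℝ} {h : ℝ ≃ₜ ℝ} (F : Finset ℝ)
    (hFB : (F : Set ℝ) ⊆ B) (hF : ∀ x : ℝ, x ∉ F → ∃ g, IsProjNear h g (x : OnePoint ℝ)) :
    IsPiecewiseProjective ⊤ B h := by
  refine ⟨F, hFB, fun I hI hd => ?_⟩
  have hI' : ∀ x ∈ I, IsProjNear h (projPart h (x : OnePoint ℝ)) (x : OnePoint ℝ) := fun x hx => by
    obtain ⟨g, hg⟩ := hF x fun hxF => Set.disjoint_left.1 hd hx hxF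
    exact isProjNear_projPart hg
  rcases I.eq_empty_or_nonempty with rfl | ⟨x₀, hx₀⟩
  · exact ⟨1, one_mem _, by simp⟩
  refine ⟨projPart h (x₀ : OnePoint ℝ), mem_SL2_iff.2 fun _ _ => Subring.mem_top _,
    fun x hx => ?_⟩
  have key := hI.isPreconnected.induction₂
    (fun x y : ℝ => ∀ z : OnePoint ℝ,
      mob ℝ (projPart h (x : OnePoint ℝ)) z = mob ℝ (projPart h (y : OnePoint ℝ)) z)
    (fun x hx => by
      have h1 : ∀ᶠ y in 𝓝 (x : OnePoint ℝ), IsProjNear h (projPart h (x : OnePoint ℝ)) y :=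
        eventually_eventually_nhds.2 (hI' x hx)
      have h2 : ∀ᶠ y : ℝ in 𝓝 x, IsProjNear h (projPart h (x : OnePoint ℝ)) (y : OnePoint ℝ) :=
        (OnePoint.continuous_coe.tendsto x).eventually h1
      refine nhdsWithin_le_nhds (h2.mono fun y hy z => ?_)
      exact IsProjNear.mob_eq hy (isProjNear_projPart hy) z)
    (fun x y z _ _ _ h1 h2 w => (h1 w).trans (h2 w))
    (fun x y _ _ h1 w => (h1 w).symm) hx₀ hx
  rw [(hI' x hx).apply_eq, key]

theorem mem_hyperbolicFixedPoints_rat (q : ℚ) : (q : ℝ) ∈ hyperbolicFixedPoints ⊤ := by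
  -- The matrix is the conjugate of `diag(2, 1/2)` by the translation by `q`.
  refine ⟨⟨!![2, -3 * q / 2; 0, 1 / 2], by simp [Matrix.det_fin_two]⟩,
    mem_SL2_iff.2 fun _ _ => Subring.mem_top _, ?_, ?_⟩
  · norm_num [Matrix.trace_fin_two]
  · refine (mob_coe_eq_coe_iff _ _ _).2 ?_
    simp
    ring

/-- A real fixed point of a non-trivial element of `SL₂(ℚ)` is fixed by a hyperbolic element: if
the given element is parabolic, the point is rational. -/
theorem mem_hyperbolicFixedPoints_of_mob_eq {g : SL(2, ℚ)} {x : ℝ}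
    (hx : mob ℝ g (x : OnePoint ℝ) = (x : OnePoint ℝ)) (hg : ¬ ∀ z : OnePoint ℝ, mob ℝ g z = z) :
    x ∈ hyperbolicFixedPoints ⊤ := by
  by_cases hr : ∃ q : ℚ, (q : ℝ) = x
  · obtain ⟨q, rfl⟩ := hr
    exact mem_hyperbolicFixedPoints_rat q
  have hlin : ∀ u v : ℚ, (u : ℝ) * x + v = 0 → u = 0 := by
    intro u v huv
    by_contra hu
    have hu' : (u : ℝ) ≠ 0 := by exact_mod_cast hu
    refine hr ⟨-v / u, ?_⟩
    push_cast
    field_simp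
    linarith
  refine ⟨g, mem_SL2_iff.2 fun _ _ => Subring.mem_top _, ?_, hx⟩
  obtain ⟨hne, e⟩ := (mob_coe_eq_coe_iff _ _ _).1 hx
  rw [eq_div_iff hne] at e
  simp only [eq_ratCast] at e
  have hdet := g.det_coe
  rw [Matrix.det_fin_two] at hdet
  have hc : g 1 0 ≠ 0 := by
    intro hc
    have h1 := hlin (g 1 1 - g 0 0) (- g 0 1) (by
      rw [hc] at e
      push_cast at e ⊢
      linarith)
    have had : g 0 0 = g 1 1 := by linarith
    have hb : g 0 1 = 0 := by
      rw [hc, had] at e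
      push_cast at e
      have : ((g 0 1 : ℚ) : ℝ) = 0 := by linarith
      exact_mod_cast this
    exact hg fun z => mob_eq_self_of_scalar hc hb had z
  -- The square of the derivative of the quadratic fixed-point equation is its discriminant.
  have hs : (2 * (g 1 0 : ℝ) * x + (g 1 1 - g 0 0)) ^ 2 = ((g 0 0 + g 1 1) ^ 2 - 4 : ℝ) := by
    have hdet' : ((g 0 0 : ℚ) : ℝ) * (g 1 1 : ℚ) - (g 0 1 : ℚ) * (g 1 0 : ℚ) = 1 := by
      exact_mod_cast hdet
    linear_combination (4 * (g 1 0 : ℝ)) * e - 4 * hdet'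
  have hpos : 0 < (2 * (g 1 0 : ℝ) * x + (g 1 1 - g 0 0)) ^ 2 := by
    refine sq_pos_of_ne_zero fun h0 => hc ?_
    have := hlin (2 * g 1 0) (g 1 1 - g 0 0) (by push_cast; exact h0)
    linarith
  rw [hs] at hpos
  have hpos' : (2 : ℚ) ^ 2 < (g 0 0 + g 1 1) ^ 2 := by
    have : (4 : ℝ) < (g 0 0 + g 1 1) ^ 2 := by linarith
    norm_num
    exact_mod_cast this
  rw [Matrix.trace_fin_two]
  simpa using sq_lt_sq.1 hpos'

/-- At a breakpoint that is not a fixed point of a hyperbolic element, the matrices on the two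
sides act in the same way, because they agree at the point. -/
theorem IsPiecewiseProjective.mem_HQ {A : Subring ℚ} {B : Set ℝ} {h : ℝ ≃ₜ ℝ}
    (hh : IsPiecewiseProjective A B h) : h ∈ HQ := by
  classical
  obtain ⟨F, -, hF⟩ := hh
  refine isPiecewiseProjective_top_of_isProjNear (F.filter (· ∈ hyperbolicFixedPoints ⊤))
    (fun x hx => (Finset.mem_filter.1 hx).2) fun x hx => ?_
  have hU : ((F.erase x : Finset ℝ) : Set ℝ)ᶜ ∈ 𝓝 x :=
    (F.erase x).finite_toSet.isClosed.isOpen_compl.mem_nhds (by simp)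
  obtain ⟨ε, hε, hball⟩ := Metric.mem_nhds_iff.1 hU
  rw [Real.ball_eq_Ioo] at hball
  by_cases hxF : x ∈ F
  · have hnot : x ∉ hyperbolicFixedPoints ⊤ := fun hm => hx (Finset.mem_filter.2 ⟨hxF, hm⟩)
    obtain ⟨g, -, e⟩ := hF (Ioo (x - ε) x) ordConnected_Ioo (Set.disjoint_left.2 fun z hz hzF =>
      hball ⟨hz.1, by linarith [hz.2]⟩ (by simpa using ⟨hzF, hz.2.ne⟩))
    obtain ⟨g', -, e'⟩ := hF (Ioo x (x + ε)) ordConnected_Ioo (Set.disjoint_left.2 fun z hz hzF =>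
      hball ⟨by linarith [hz.1], hz.2⟩ (by simpa using ⟨hzF, hz.1.ne'⟩))
    have l1 := ((OnePoint.continuous_coe.comp h.continuous).tendsto x)
    have l2 := fun k : SL(2, ℚ) => ((continuous_mob (K := ℝ) k).comp
      OnePoint.continuous_coe).tendsto x
    have hx1 : mob ℝ g (x : OnePoint ℝ) = ((h x : ℝ) : OnePoint ℝ) := by
      refine tendsto_nhds_unique (((l2 g).mono_left (nhdsWithin_le_nhds (s := Iio x))).congr' ?_)
        (l1.mono_left nhdsWithin_le_nhds)
      filter_upwards [Ioo_mem_nhdsLT (show x - ε < x by linarith)] with z hz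
      exact (e z hz).symm
    have hx2 : mob ℝ g' (x : OnePoint ℝ) = ((h x : ℝ) : OnePoint ℝ) := by
      refine tendsto_nhds_unique (((l2 g').mono_left (nhdsWithin_le_nhds (s := Ioi x))).congr' ?_)
        (l1.mono_left nhdsWithin_le_nhds)
      filter_upwards [Ioo_mem_nhdsGT (show x < x + ε by linarith)] with z hz
      exact (e' z hz).symm
    have htriv : ∀ z : OnePoint ℝ, mob ℝ (g⁻¹ * g') z = z := by
      by_contra hne
      refine hnot (mem_hyperbolicFixedPoints_of_mob_eq ?_ hne)
      rw [mob_mul, hx2, ← hx1, mob_inv_mob]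
    refine ⟨g, ?_⟩
    rw [IsProjNear, OnePoint.nhds_coe_eq, eventually_map]
    filter_upwards [Ioo_mem_nhds (show x - ε < x by linarith) (show x < x + ε by linarith)]
      with z hz
    rw [extendP1_coe]
    rcases lt_trichotomy z x with hlt | rfl | hgt
    · exact e z ⟨hz.1, hlt⟩
    · exact hx1.symm
    · have hz' := htriv (z : OnePoint ℝ)
      rw [mob_mul] at hz'
      rw [e' z ⟨hgt, hz.2⟩, ← mob_mob_inv g (mob ℝ g' z), hz']
  · obtain ⟨g, -, e⟩ := hF (Ioo (x - ε) (x + ε)) ordConnected_Ioo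
      (Set.disjoint_left.2 fun z hz hzF => by
        have hzx : z ≠ x := fun h => hxF (h ▸ hzF)
        exact hball hz (by simpa using ⟨hzF, hzx⟩))
    refine ⟨g, ?_⟩
    rw [IsProjNear, OnePoint.nhds_coe_eq, eventually_map]
    filter_upwards [Ioo_mem_nhds (show x - ε < x by linarith) (show x < x + ε by linarith)]
      with z hz using e z hz

theorem Gamma_le_HQ (S : Set ℕ) : Gamma S ≤ HQ := fun _ hh => IsPiecewiseProjective.mem_HQ hh

/-! ### Measurable maps to probability measures on the `p`-adic projective line -/

section realisation

open scoped NNReal ENNReal CompactlySupported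

variable {p : ℕ} [Fact p.Prime]

instance : PolishSpace (OnePoint ℚ_[p]) := by
  let := TopologicalSpace.metrizableSpaceMetric (OnePoint ℚ_[p])
  infer_instance

instance : SigmaFinite volP1 := by
  rw [volP1]
  exact measurableEmbedding_coeP1.sigmaFinite_map

theorem continuous_integral_left (c : C(OnePoint ℚ_[p], ℝ)) :
    Continuous fun ν : ProbP1 p => ∫ y, c y ∂(ν : Measure (OnePoint ℚ_[p])) :=
  ProbabilityMeasure.continuous_integral_continuousMap c

theorem continuous_integral_right (ν : ProbP1 p) :
    Continuous fun c : C(OnePoint ℚ_[p], ℝ) => ∫ y, c y ∂(ν : Measure (OnePoint ℚ_[p])) :=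
  continuous_integral_pair.comp (by fun_prop : Continuous fun c => (ν, c))

theorem probP1_ext_of_dense {ν ν' : ProbP1 p}
    (h : ∀ n : ℕ, ∫ y, TopologicalSpace.denseSeq C(OnePoint ℚ_[p], ℝ) n y
        ∂(ν : Measure (OnePoint ℚ_[p])) =
      ∫ y, TopologicalSpace.denseSeq C(OnePoint ℚ_[p], ℝ) n y ∂(ν' : Measure (OnePoint ℚ_[p]))) :
    ν = ν' := by
  have h' := (TopologicalSpace.denseRange_denseSeq C(OnePoint ℚ_[p], ℝ)).equalizer
    (continuous_integral_right ν) (continuous_integral_right ν') (funext h)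
  exact Subtype.ext (ext_of_forall_integral_eq_of_IsFiniteMeasure
    (μ := (ν : Measure (OnePoint ℚ_[p]))) (ν := (ν' : Measure (OnePoint ℚ_[p])))
    fun c => congrFun h' c.toContinuousMap)

/-- Integration against a dense sequence of continuous functions embeds the compact space of
probability measures in a product of lines, so that measurability can be tested on each of them. -/
theorem aestronglyMeasurable_probP1 {α : Type*} {m : MeasurableSpace α} {μ : Measure α}
    {f : α → ProbP1 p}
    (h : ∀ c : C(OnePoint ℚ_[p], ℝ),
      AEStronglyMeasurable (fun x => ∫ y, c y ∂(f x : Measure (OnePoint ℚ_[p]))) μ) :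
    AEStronglyMeasurable f μ := by
  let e : ProbP1 p → ℕ → ℝ := fun ν n =>
    ∫ y, TopologicalSpace.denseSeq C(OnePoint ℚ_[p], ℝ) n y ∂(ν : Measure (OnePoint ℚ_[p]))
  have he : IsClosedEmbedding e := Continuous.isClosedEmbedding
    (continuous_pi fun n => continuous_integral_left _)
    fun ν ν' hν => probP1_ext_of_dense fun n => congrFun hν n
  refine he.isEmbedding.aestronglyMeasurable_comp_iff.1 ?_
  exact (aemeasurable_pi_lambda _ fun n => (h _).aemeasurable).aestronglyMeasurable

theorem MapSpace.aestronglyMeasurable_integral (f : MapSpace p) (c : C(OnePoint ℚ_[p], ℝ)) :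
    AEStronglyMeasurable (fun x => ∫ y, c y ∂(f x : Measure (OnePoint ℚ_[p]))) volP1 :=
  (continuous_integral_left c).comp_aestronglyMeasurable f.aestronglyMeasurable

theorem pairing_indicatorConstLp (f : MapSpace p) {s : Set (OnePoint ℝ)} (hs : MeasurableSet s)
    (hs' : volP1 s ≠ ⊤) (c : C(OnePoint ℚ_[p], ℝ)) :
    pairing p f (indicatorConstLp 1 hs hs' c) =
      ∫ x in s, ∫ y, c y ∂(f x : Measure (OnePoint ℚ_[p])) ∂volP1 := by
  rw [pairing_apply, ← integral_indicator hs]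
  refine integral_congr_ae ?_
  filter_upwards [indicatorConstLp_coeFn (p := 1) (hs := hs) (hμs := hs') (c := c)] with x hx
  rw [hx]
  by_cases hxs : x ∈ s <;> simp [hxs]

theorem pairing_injective : Function.Injective (pairing p) := by
  intro f f' h
  have h1 : ∀ c : C(OnePoint ℚ_[p], ℝ),
      (fun x => ∫ y, c y ∂(f x : Measure (OnePoint ℚ_[p]))) =ᵐ[volP1]
        fun x => ∫ y, c y ∂(f' x : Measure (OnePoint ℚ_[p])) := by
    intro c
    have hint : ∀ (k : MapSpace p) (s : Set (OnePoint ℝ)), volP1 s < ⊤ →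
        IntegrableOn (fun x => ∫ y, c y ∂(k x : Measure (OnePoint ℚ_[p]))) s volP1 :=
      fun k s hs => Measure.integrableOn_of_bounded hs.ne (k.aestronglyMeasurable_integral c)
        (M := ‖c‖) (ae_of_all _ fun x => norm_integral_continuousMap_le (k x) c)
    refine ae_eq_of_forall_setIntegral_eq_of_sigmaFinite (fun s _ hs => hint f s hs)
      (fun s _ hs => hint f' s hs) fun s hs hs' => ?_
    rw [← pairing_indicatorConstLp f hs hs'.ne, h, pairing_indicatorConstLp]
  refine MapSpace.ext ?_
  have h2 := ae_all_iff.2 fun n => h1 (TopologicalSpace.denseSeq C(OnePoint ℚ_[p], ℝ) n)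
  filter_upwards [h2] with x hx using probP1_ext_of_dense hx

/-! ### Compactness and convexity of the space of measurable maps -/

theorem withDensitySMulLI_surjective {α E : Type*} [MeasurableSpace α] {μ : Measure α}
    [NormedAddCommGroup E] [NormedSpace ℝ E] {w : α → ℝ≥0} (hw : Measurable w)
    (hpos : ∀ x, 0 < w x) :
    Function.Surjective (withDensitySMulLI μ (E := E) hw) := by
  intro φ
  have hint : Integrable (fun x => (w x)⁻¹ • φ x) (μ.withDensity fun x => (w x : ℝ≥0∞)) := by
    rw [integrable_withDensity_iff_integrable_smul hw]
    refine (L1.integrable_coeFn φ).congr (ae_of_all _ fun x => ?_)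
    simp only
    rw [smul_inv_smul₀ (hpos x).ne']
  refine ⟨hint.toL1 _, ?_⟩
  rw [withDensitySMulLI_apply]
  refine Lp.ext ?_
  have h2 := (ae_withDensity_iff hw.coe_nnreal_ennreal).1 hint.coeFn_toL1
  filter_upwards [(memL1_smul_of_L1_withDensity hw (hint.toL1 _)).coeFn_toLp, h2] with x h3 h4
  rw [h3, h4 (by simpa using (hpos x).ne'), smul_inv_smul₀ (hpos x).ne']

variable {w : OnePoint ℝ → ℝ≥0}

/-- A continuous function on `P¹(ℝ) × P¹(ℚ_p)`, curried and multiplied by a density `w` of a finite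
measure, as an element of `L¹(P¹(ℝ), C(P¹(ℚ_p)))`. -/
noncomputable def weightedL1 (p : ℕ) [Fact p.Prime] (hw : Measurable w)
    [IsFiniteMeasure (volP1.withDensity fun x => (w x : ℝ≥0∞))] :
    C(OnePoint ℝ, C(OnePoint ℚ_[p], ℝ)) →L[ℝ] L1C p :=
  (withDensitySMulLI volP1 hw).toContinuousLinearMap.comp
    (ContinuousMap.toLp 1 (volP1.withDensity fun x => (w x : ℝ≥0∞)) ℝ)

variable (hw : Measurable w) [IsFiniteMeasure (volP1.withDensity fun x => (w x : ℝ≥0∞))]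

theorem coeFn_weightedL1 (ψ : C(OnePoint ℝ, C(OnePoint ℚ_[p], ℝ))) :
    weightedL1 p hw ψ =ᵐ[volP1] fun x => w x • ψ x := by
  have h1 := (memL1_smul_of_L1_withDensity hw
    (ContinuousMap.toLp 1 (volP1.withDensity fun x => (w x : ℝ≥0∞)) ℝ ψ)).coeFn_toLp
  have h2 := (ae_withDensity_iff hw.coe_nnreal_ennreal).1
    (ContinuousMap.coeFn_toLp (p := 1) (𝕜 := ℝ) (volP1.withDensity fun x => (w x : ℝ≥0∞)) ψ)
  filter_upwards [h1, h2] with x h3 h4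
  refine h3.trans ?_
  by_cases hx : w x = 0
  · rw [hx, zero_smul, zero_smul]
  · rw [h4 (by simpa using hx)]

theorem denseRange_weightedL1 (hpos : ∀ x, 0 < w x) : DenseRange (weightedL1 p hw) :=
  (withDensitySMulLI_surjective hw hpos).denseRange.comp
    (ContinuousMap.toLp_denseRange _ _ ℝ ENNReal.one_ne_top)
    (withDensitySMulLI volP1 hw).continuous

theorem pairing_weightedL1 (f : MapSpace p) (ψ : C(OnePoint ℝ, C(OnePoint ℚ_[p], ℝ))) :
    pairing p f (weightedL1 p hw ψ) = ∫ x, ∫ y, ψ x y ∂(f x : Measure (OnePoint ℚ_[p]))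
      ∂(volP1.withDensity fun x => (w x : ℝ≥0∞)) := by
  rw [pairing_apply, integral_withDensity_eq_integral_smul hw]
  refine integral_congr_ae ?_
  filter_upwards [coeFn_weightedL1 hw ψ] with x hx
  rw [hx]
  exact integral_const_mul (w x : ℝ) _

/-- The image of `K_p` is cut out by positivity and by the values on the functions that do not
depend on the `p`-adic variable. A functional with these properties is a measure on the compact
space `P¹(ℝ) × P¹(ℚ_p)` by the Riesz-Markov-Kakutani theorem, and disintegration over `P¹(ℝ)`
gives the map. -/
theorem mem_range_pairing_iff (hpos : ∀ x, 0 < w x) (Λ : WeakDual ℝ (L1C p)) :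
    Λ ∈ range (pairing p) ↔
      (∀ ψ : C(OnePoint ℝ × OnePoint ℚ_[p], ℝ), 0 ≤ ψ → 0 ≤ Λ (weightedL1 p hw ψ.curry)) ∧
      ∀ c : C(OnePoint ℝ, ℝ),
        Λ (weightedL1 p hw (c.comp (ContinuousMap.fst :
          C(OnePoint ℝ × OnePoint ℚ_[p], OnePoint ℝ))).curry) =
          ∫ x, c x ∂(volP1.withDensity fun x => (w x : ℝ≥0∞)) := by
  constructor
  · rintro ⟨f, rfl⟩
    refine ⟨fun ψ hψ => ?_, fun c => ?_⟩
    · rw [pairing_weightedL1]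
      exact integral_nonneg fun x => integral_nonneg fun y => hψ (x, y)
    · rw [pairing_weightedL1]
      simp
  · rintro ⟨h0, h1⟩
    let Λ' : C_c(OnePoint ℝ × OnePoint ℚ_[p], ℝ) →ₚ[ℝ] ℝ :=
      { toFun := fun ψ => Λ (weightedL1 p hw (ψ : C(OnePoint ℝ × OnePoint ℚ_[p], ℝ)).curry)
        map_add' := fun ψ ψ' => by
          rw [← map_add, ← map_add]
          rfl
        map_smul' := fun r ψ => by
          rw [RingHom.id_apply, ← _root_.map_smul, ← _root_.map_smul]
          rfl
        monotone' := fun ψ ψ' h => by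
          have := h0 ((ψ' : C(OnePoint ℝ × OnePoint ℚ_[p], ℝ)) - ψ) fun x => sub_nonneg.2 (h x)
          rw [← sub_nonneg, ← map_sub, ← map_sub]
          exact this }
    set ρ := RealRMK.rieszMeasure Λ' with hρ
    have hint : ∀ ψ : C(OnePoint ℝ × OnePoint ℚ_[p], ℝ),
        ∫ z, ψ z ∂ρ = Λ (weightedL1 p hw ψ.curry) := fun ψ =>
      RealRMK.integral_rieszMeasure Λ' (CompactlySupportedContinuousMap.continuousMapEquiv ψ)
    have hfin : IsFiniteMeasure ρ := inferInstance
    have hintg : ∀ ψ : C(OnePoint ℝ × OnePoint ℚ_[p], ℝ), Integrable ψ ρ := fun ψ =>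
      (BoundedContinuousFunction.mkOfCompact ψ).integrable ρ
    have hfst : ρ.fst = volP1.withDensity fun x => (w x : ℝ≥0∞) := by
      refine ext_of_forall_integral_eq_of_IsFiniteMeasure fun c => ?_
      rw [Measure.fst, integral_map measurable_fst.aemeasurable
        c.continuous.aestronglyMeasurable]
      exact (hint _).trans (h1 c.toContinuousMap)
    let f₀ : OnePoint ℝ → ProbP1 p := fun x => ⟨ρ.condKernel x, inferInstance⟩
    have hf₀ : AEStronglyMeasurable f₀ volP1 := aestronglyMeasurable_probP1 fun c =>
      StronglyMeasurable.aestronglyMeasurable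
        (StronglyMeasurable.integral_kernel (κ := ρ.condKernel) c.continuous.stronglyMeasurable)
    let f : MapSpace p := AEEqFun.mk f₀ hf₀
    have hf : f =ᵐ[volP1] f₀ := AEEqFun.coeFn_mk _ _
    refine ⟨f, ?_⟩
    refine DFunLike.coe_injective ((denseRange_weightedL1 hw hpos).equalizer
      (pairing p f).continuous Λ.continuous (funext fun ψ => ?_))
    have e := hint ψ.uncurry
    rw [← Measure.integral_condKernel (hintg _), hfst] at e
    refine (pairing_weightedL1 hw f ψ).trans (Eq.trans ?_ e)
    refine integral_congr_ae ?_
    filter_upwards [withDensity_absolutelyContinuous volP1 _ hf] with x hx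
    rw [hx]
    rfl

theorem exists_finite_density : ∃ w : OnePoint ℝ → ℝ≥0, (∀ x, 0 < w x) ∧ Measurable w ∧
    IsFiniteMeasure (volP1.withDensity fun x => (w x : ℝ≥0∞)) := by
  obtain ⟨w, h1, h2, h3⟩ := exists_pos_lintegral_lt_of_sigmaFinite volP1 one_ne_zero
  exact ⟨w, h1, h2, isFiniteMeasure_withDensity (h3.trans ENNReal.one_lt_top).ne⟩

theorem convex_range_pairing : Convex ℝ (range (pairing p)) := by
  obtain ⟨w, hpos, hw, hfin⟩ := exists_finite_density
  intro Λ hΛ Λ' hΛ' a b ha hb hab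
  rw [mem_range_pairing_iff hw hpos] at hΛ hΛ' ⊢
  have e : ∀ φ, (a • Λ + b • Λ') φ = a * Λ φ + b * Λ' φ := fun φ => rfl
  refine ⟨fun ψ hψ => ?_, fun c => ?_⟩
  · rw [e]
    exact add_nonneg (mul_nonneg ha (hΛ.1 ψ hψ)) (mul_nonneg hb (hΛ'.1 ψ hψ))
  · rw [e, hΛ.2, hΛ'.2, ← add_mul, hab, one_mul]

theorem isCompact_range_pairing : IsCompact (range (pairing p)) := by
  obtain ⟨w, hpos, hw, hfin⟩ := exists_finite_density
  refine (WeakDual.isCompact_closedBall (𝕜 := ℝ) (E := L1C p) 0 1).of_isClosed_subset ?_ ?_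
  · have e : range (pairing p) =
        (⋂ (ψ : C(OnePoint ℝ × OnePoint ℚ_[p], ℝ)) (_ : 0 ≤ ψ),
          {Λ : WeakDual ℝ (L1C p) | 0 ≤ Λ (weightedL1 p hw ψ.curry)}) ∩
        ⋂ c : C(OnePoint ℝ, ℝ), {Λ : WeakDual ℝ (L1C p) |
          Λ (weightedL1 p hw (c.comp (ContinuousMap.fst :
            C(OnePoint ℝ × OnePoint ℚ_[p], OnePoint ℝ))).curry) =
              ∫ x, c x ∂(volP1.withDensity fun x => (w x : ℝ≥0∞))} := by
      ext Λ
      rw [mem_range_pairing_iff hw hpos]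
      simp
    rw [e]
    refine IsClosed.inter ?_ ?_
    · exact isClosed_biInter fun ψ _ => isClosed_le continuous_const (WeakDual.eval_continuous _)
    · exact isClosed_iInter fun c => isClosed_eq (WeakDual.eval_continuous _) continuous_const
  · rintro _ ⟨f, rfl⟩
    simp only [mem_preimage, mem_closedBall_zero_iff]
    refine ContinuousLinearMap.opNorm_le_bound _ zero_le_one fun φ => ?_
    rw [one_mul, L1.norm_eq_integral_norm]
    exact norm_integral_le_of_norm_le (L1.integrable_coeFn φ).norm
      (ae_of_all _ fun x => norm_integral_continuousMap_le (f x) (φ x))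

end realisation

/-! ### The action by affine homeomorphisms -/

section action

variable {p : ℕ} [Fact p.Prime]

/-- The composition of `c` with the action of `g` on `P¹(ℚ_p)`. -/
noncomputable def compMob (p : ℕ) [Fact p.Prime] (g : SL(2, ℚ)) (c : C(OnePoint ℚ_[p], ℝ)) :
    C(OnePoint ℚ_[p], ℝ) :=
  c.comp ⟨mob ℚ_[p] g, continuous_mob g⟩

theorem norm_compMob_le (g : SL(2, ℚ)) (c : C(OnePoint ℚ_[p], ℝ)) : ‖compMob p g c‖ ≤ ‖c‖ :=
  (ContinuousMap.norm_le _ (norm_nonneg _)).2 fun y => c.norm_coe_le_norm (mob ℚ_[p] g y)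

theorem integral_push (g : SL(2, ℚ)) (ν : ProbP1 p) (c : C(OnePoint ℚ_[p], ℝ)) :
    ∫ y, c y ∂(push p g ν : Measure (OnePoint ℚ_[p])) =
      ∫ y, compMob p g c y ∂(ν : Measure (OnePoint ℚ_[p])) :=
  integral_map (continuous_mob g).aemeasurable c.continuous.aestronglyMeasurable

theorem aestronglyMeasurable_compMob_projPart (h : HQ) {φ : OnePoint ℝ → C(OnePoint ℚ_[p], ℝ)}
    (hφ : AEStronglyMeasurable φ volP1) :
    AEStronglyMeasurable (fun x => compMob p (projPart h x) (φ x)) volP1 := by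
  let s : SL(2, ℚ) → Set (OnePoint ℝ) := fun g => {x | IsProjNear h g x}
  have hs : ∀ g, MeasurableSet (s g) := fun g => isOpen_setOfPred_eventually_nhds.measurableSet
  have hcov : volP1.restrict (⋃ g, s g) = volP1 := by
    refine Measure.restrict_eq_self_of_ae_mem ?_
    rw [ae_volP1_iff]
    filter_upwards [IsPiecewiseProjective.ae_exists_isProjNear h.2] with x hx
    simpa [s] using hx
  have hc : Countable (Matrix (Fin 2) (Fin 2) ℚ) :=
    inferInstanceAs (Countable (Fin 2 → Fin 2 → ℚ))
  have : Countable SL(2, ℚ) := Subtype.countable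
  suffices H : AEStronglyMeasurable (fun x => compMob p (projPart h x) (φ x))
      (volP1.restrict (⋃ g, s g)) by rwa [hcov] at H
  refine aestronglyMeasurable_iUnion_iff.2 fun g => ?_
  have hg : AEStronglyMeasurable (fun x => compMob p g (φ x)) (volP1.restrict (s g)) :=
    (ContinuousMap.continuous_precomp _).comp_aestronglyMeasurable hφ.restrict
  refine hg.congr ?_
  rw [EventuallyEq, ae_restrict_iff' (hs g), ae_volP1_iff]
  refine ae_of_all _ fun x hx => ContinuousMap.ext fun z => ?_
  exact congrArg (φ x) (IsProjNear.mob_eq hx (isProjNear_projPart hx) z)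

/-- The action of `h` on `K_p` has an adjoint on `L¹(P¹(ℝ), C(P¹(ℚ_p)))`: `φ` is transported by
the projective parts of `h` and multiplied by the Radon-Nikodym derivative of `h`. -/
theorem exists_adjoint (h : HQ) (φ : L1C p) :
    ∃ φ' : L1C p, ∀ f : MapSpace p, pairing p (h • f) φ = pairing p f φ' := by
  let T : OnePoint ℝ ≃ₜ OnePoint ℝ := extendP1 (h : ℝ ≃ₜ ℝ)
  let T' : OnePoint ℝ → OnePoint ℝ := extendP1 ((h⁻¹ : HQ) : ℝ ≃ₜ ℝ)
  have hTT' : ∀ x, T (T' x) = x := fun x => by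
    induction x using OnePoint.rec with
    | infty => rfl
    | coe x => exact congrArg OnePoint.some ((h : ℝ ≃ₜ ℝ).apply_symm_apply x)
  have hT' : MeasurableEmbedding T' :=
    (extendP1 ((h⁻¹ : HQ) : ℝ ≃ₜ ℝ)).toMeasurableEquiv.measurableEmbedding
  let ν : Measure (OnePoint ℝ) := Measure.map T' volP1
  have : SigmaFinite ν := hT'.sigmaFinite_map
  have hν : ν ≪ volP1 := (quasiMeasurePreserving_extendP1 h⁻¹).absolutelyContinuous
  let V : OnePoint ℝ → C(OnePoint ℚ_[p], ℝ) := fun x => compMob p (projPart h x) (φ (T x))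
  have hVm : AEStronglyMeasurable V volP1 := aestronglyMeasurable_compMob_projPart h
    ((Lp.aestronglyMeasurable φ).comp_quasiMeasurePreserving (quasiMeasurePreserving_extendP1 h))
  have hV : Integrable V ν := by
    have h1 : Integrable (fun x => φ (T x)) ν := by
      refine hT'.integrable_map_iff.2 ((L1.integrable_coeFn φ).congr (ae_of_all _ fun x => ?_))
      simp only [Function.comp_apply, hTT']
    exact h1.mono (hVm.mono_ac hν) (ae_of_all _ fun x => norm_compMob_le _ _)
  have hU : Integrable (fun x => (ν.rnDeriv volP1 x).toReal • V x) volP1 :=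
    (integrable_rnDeriv_smul_iff hν).2 hV
  refine ⟨hU.toL1 _, fun f => ?_⟩
  calc pairing p (h • f) φ
      = ∫ x, ∫ y, φ x y ∂(actFun h f x : Measure (OnePoint ℚ_[p])) ∂volP1 := by
        rw [pairing_apply]
        refine integral_congr_ae ?_
        filter_upwards [coeFn_smul h f] with x hx
        rw [hx]
    _ = ∫ x, (fun x' => ∫ y, V x' y ∂(f x' : Measure (OnePoint ℚ_[p]))) (T' x) ∂volP1 := by
        refine integral_congr_ae (ae_of_all _ fun x => ?_)
        simp only [V, hTT']
        exact integral_push _ _ _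
    _ = ∫ x, ∫ y, V x y ∂(f x : Measure (OnePoint ℚ_[p])) ∂ν :=
        (hT'.integral_map fun x' => ∫ y, V x' y ∂(f x' : Measure (OnePoint ℚ_[p]))).symm
    _ = ∫ x, (ν.rnDeriv volP1 x).toReal • ∫ y, V x y ∂(f x : Measure (OnePoint ℚ_[p])) ∂volP1 :=
        (integral_rnDeriv_smul hν).symm
    _ = pairing p f (hU.toL1 _) := by
        rw [pairing_apply]
        refine integral_congr_ae ?_
        filter_upwards [hU.coeFn_toL1] with x hx
        rw [hx]
        exact (integral_const_mul _ _).symm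

theorem isConvexCompactSpace_mapSpace (p : ℕ) [Fact p.Prime] :
    IsConvexCompactSpace HQ (MapSpace p) (WeakDual ℝ (L1C p)) (pairing p) where
  injective := pairing_injective
  isCompact := isCompact_range_pairing
  convex := convex_range_pairing
  continuous_smul h := by
    let _ : TopologicalSpace (MapSpace p) := TopologicalSpace.induced (pairing p) inferInstance
    rw [continuous_induced_rng]
    refine WeakDual.continuous_of_continuous_eval fun φ => ?_
    obtain ⟨φ', hφ'⟩ := exists_adjoint h φ
    have : (fun f : MapSpace p => pairing p (h • f) φ) = fun f => pairing p f φ' := funext hφ'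
    refine (congrArg Continuous this).mpr ?_
    exact (WeakDual.eval_continuous φ').comp continuous_induced_dom
  affine_smul h f f' k a b _ _ _ e := by
    refine DFunLike.ext _ _ fun φ => ?_
    obtain ⟨φ', hφ'⟩ := exists_adjoint h φ
    have e' := DFunLike.congr_fun e φ'
    calc pairing p (h • k) φ = pairing p k φ' := hφ' k
      _ = a * pairing p f φ' + b * pairing p f' φ' := e'
      _ = a * pairing p (h • f) φ + b * pairing p (h • f') φ := by rw [hφ', hφ']

end action

/-! ### An invariant measure for matrices with `p`-integral entries -/

section invariant

open Classical in
/-- The point `[x : y]` of the projective line. At `x = y = 0` the value is `∞`. -/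
noncomputable def ratio {K : Type*} [Field K] (x y : K) : OnePoint K :=
  if y = 0 then ∞ else ((x / y : K) : OnePoint K)

theorem mob_ratio {K : Type*} [Field K] [Algebra ℚ K] (g : SL(2, ℚ)) {x y : K}
    (h : x ≠ 0 ∨ y ≠ 0) :
    mob K g (ratio x y) =
      ratio (algebraMap ℚ K (g 0 0) * x + algebraMap ℚ K (g 0 1) * y)
        (algebraMap ℚ K (g 1 0) * x + algebraMap ℚ K (g 1 1) * y) := by
  have e : ∀ i j, (Matrix.SpecialLinearGroup.mapGL K g) i j = algebraMap ℚ K (g i j) :=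
    fun i j => rfl
  let _ := Classical.decEq K
  change Matrix.SpecialLinearGroup.mapGL K g • ratio x y = _
  by_cases hy : y = 0
  · have hx : x ≠ 0 := h.resolve_right (not_not.2 hy)
    subst hy
    rw [ratio, if_pos rfl, OnePoint.smul_infty_eq_ite, ratio]
    simp only [e, mul_zero, add_zero, mul_eq_zero, hx, or_false]
    split_ifs with h0
    · rfl
    · rw [mul_div_mul_right _ _ hx]
  · rw [ratio, if_neg hy, OnePoint.smul_some_eq_ite, ratio]
    simp only [e]
    have h1 : algebraMap ℚ K (g 1 0) * (x / y) + algebraMap ℚ K (g 1 1) =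
        (algebraMap ℚ K (g 1 0) * x + algebraMap ℚ K (g 1 1) * y) / y := by
      field_simp
    have h2 : algebraMap ℚ K (g 0 0) * (x / y) + algebraMap ℚ K (g 0 1) =
        (algebraMap ℚ K (g 0 0) * x + algebraMap ℚ K (g 0 1) * y) / y := by
      field_simp
    simp only [h1, h2, div_eq_zero_iff, hy, or_false]
    split_ifs with h0
    · rfl
    · rw [div_div_div_cancel_right₀ hy]

/-- The image in `P¹(ℚ_p)` of the Haar measure of `ℤ_p²` is invariant under matrices with
`p`-integral entries, because these act on `ℤ_p²` by automorphisms. -/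
theorem exists_invariant_probP1 (p : ℕ) [Fact p.Prime] : ∃ ν : ProbP1 p, ∀ g : SL(2, ℚ),
    (∀ i j, ‖algebraMap ℚ ℚ_[p] (g i j)‖ ≤ 1) → push p g ν = ν := by
  let _ : MeasurableSpace (ℤ_[p] × ℤ_[p]) := borel _
  have : BorelSpace (ℤ_[p] × ℤ_[p]) := ⟨rfl⟩
  let μ : Measure (ℤ_[p] × ℤ_[p]) := Measure.addHaarMeasure ⊤
  have hμ : IsProbabilityMeasure μ := ⟨Measure.addHaarMeasure_self⟩
  have hμ0 : ∀ᵐ z ∂μ, z ≠ 0 := by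
    rw [ae_iff]
    by_contra h0
    -- An atom would give the same mass to each of infinitely many points.
    have h1 : μ univ = ⊤ := by
      refine Set.infinite_univ.meas_eq_top ⟨μ {0}, by simpa using h0, fun x _ => ?_⟩
      exact (Measure.addHaar_singleton μ x).ge
    simp at h1
  let q : ℤ_[p] × ℤ_[p] → OnePoint ℚ_[p] := fun z => ratio (z.1 : ℚ_[p]) (z.2 : ℚ_[p])
  have hq : Measurable q := by
    classical
    let s : Set (ℤ_[p] × ℤ_[p]) := {z | (z.2 : ℚ_[p]) = 0}
    have hs : IsClosed s :=
      isClosed_eq (continuous_subtype_val.comp continuous_snd) continuous_const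
    have e : q = s.piecewise (fun _ => ∞)
        fun z => (((z.1 : ℚ_[p]) / (z.2 : ℚ_[p]) : ℚ_[p]) : OnePoint ℚ_[p]) := by
      funext z
      by_cases hz : (z.2 : ℚ_[p]) = 0 <;> simp [q, s, ratio, Set.piecewise, hz]
    rw [e]
    refine ContinuousOn.measurable_piecewise continuousOn_const ?_ hs.measurableSet
    refine OnePoint.continuous_coe.comp_continuousOn (ContinuousOn.div ?_ ?_ fun z hz => hz)
    · exact (continuous_subtype_val.comp continuous_fst).continuousOn
    · exact (continuous_subtype_val.comp continuous_snd).continuousOn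
  refine ⟨⟨μ.map q, Measure.isProbabilityMeasure_map hq.aemeasurable⟩, fun g hg => ?_⟩
  let k : Fin 2 → Fin 2 → ℤ_[p] := fun i j => ⟨algebraMap ℚ ℚ_[p] (g i j), hg i j⟩
  have hk : k 0 0 * k 1 1 - k 0 1 * k 1 0 = 1 := by
    apply Subtype.ext
    have := congrArg (algebraMap ℚ ℚ_[p]) g.det_coe
    rw [Matrix.det_fin_two, map_sub, map_mul, map_mul, map_one] at this
    exact this
  let A : ℤ_[p] × ℤ_[p] →+ ℤ_[p] × ℤ_[p] :=
    { toFun := fun z => (k 0 0 * z.1 + k 0 1 * z.2, k 1 0 * z.1 + k 1 1 * z.2)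
      map_zero' := by simp
      map_add' := fun z z' => by
        ext1 <;> simp only [Prod.fst_add, Prod.snd_add] <;> ring }
  have hA : Continuous A := by
    change Continuous fun z : ℤ_[p] × ℤ_[p] =>
      (k 0 0 * z.1 + k 0 1 * z.2, k 1 0 * z.1 + k 1 1 * z.2)
    fun_prop
  have hA' : Function.Surjective A := fun z => by
    refine ⟨(k 1 1 * z.1 - k 0 1 * z.2, k 0 0 * z.2 - k 1 0 * z.1), ?_⟩
    ext1
    · change k 0 0 * (k 1 1 * z.1 - k 0 1 * z.2) + k 0 1 * (k 0 0 * z.2 - k 1 0 * z.1) = z.1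
      linear_combination z.1 * hk
    · change k 1 0 * (k 1 1 * z.1 - k 0 1 * z.2) + k 1 1 * (k 0 0 * z.2 - k 1 0 * z.1) = z.2
      linear_combination z.2 * hk
  have hAμ : MeasurePreserving A μ μ := AddMonoidHom.measurePreserving hA hA' rfl
  have hqA : (fun z => mob ℚ_[p] g (q z)) =ᵐ[μ] q ∘ A := by
    filter_upwards [hμ0] with z hz
    refine mob_ratio g ?_
    by_contra hz'
    push Not at hz'
    exact hz (Prod.ext (Subtype.ext hz'.1) (Subtype.ext hz'.2))
  apply Subtype.ext
  change Measure.map (mob ℚ_[p] g) (μ.map q) = μ.map q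
  rw [Measure.map_map (continuous_mob g).measurable hq]
  refine (Measure.map_congr hqA).trans ?_
  rw [← Measure.map_map hq hA.measurable, hAμ.map_eq]

theorem norm_le_one_of_mem_ZInv {p : ℕ} [Fact p.Prime] {S : Set ℕ} (hS : ∀ q ∈ S, q.Prime)
    (hp : p ∉ S) {x : ℚ} (hx : x ∈ ZInv S) : ‖algebraMap ℚ ℚ_[p] x‖ ≤ 1 := by
  have h : ZInv S ≤ (PadicInt.subring p).comap (algebraMap ℚ ℚ_[p]) := by
    refine Subring.closure_le.2 ?_
    rintro _ ⟨q, hq, rfl⟩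
    have hpq : p.Coprime q := (Nat.coprime_primes (Fact.out : p.Prime) (hS q hq)).2
      fun e => hp (e ▸ hq)
    have h1 : ‖(q : ℚ_[p])‖ = 1 := Padic.norm_natCast_eq_one_iff.2 hpq
    change ‖algebraMap ℚ ℚ_[p] (q : ℚ)⁻¹‖ ≤ 1
    rw [map_inv₀, map_natCast, norm_inv, h1, inv_one]
  exact h hx

theorem IsPiecewiseProjective.ae_exists_mem_SL2 {A : Subring ℚ} {B : Set ℝ} {h : ℝ ≃ₜ ℝ}
    (hh : IsPiecewiseProjective A B h) :
    ∀ᵐ x : ℝ, ∃ g ∈ SL2 A, IsProjNear h g (x : OnePoint ℝ) := by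
  obtain ⟨F, -, hF⟩ := hh
  filter_upwards [F.countable_toSet.ae_notMem volume] with x hx
  have hU : (F : Set ℝ)ᶜ ∈ 𝓝 x := F.finite_toSet.isClosed.isOpen_compl.mem_nhds hx
  obtain ⟨ε, hε, hball⟩ := Metric.mem_nhds_iff.1 hU
  obtain ⟨g, hg, e⟩ := hF (Metric.ball x ε) (by rw [Real.ball_eq_Ioo]; exact ordConnected_Ioo)
    (Set.disjoint_left.2 fun z hz hzF => hball hz hzF)
  refine ⟨g, hg, ?_⟩
  rw [IsProjNear, OnePoint.nhds_coe_eq, eventually_map]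
  filter_upwards [Metric.ball_mem_nhds x hε] with y hy using e y hy

/-- When `p ∉ S`, the constant map at an invariant measure is fixed by `Γ_S`. -/
theorem exists_isFixedPoint_Gamma {p : ℕ} [Fact p.Prime] {S : Set ℕ} (hS : ∀ q ∈ S, q.Prime)
    (hp : p ∉ S) : ∃ f : MapSpace p, IsFixedPoint ((Gamma S).subgroupOf HQ) f := by
  obtain ⟨ν, hν⟩ := exists_invariant_probP1 p
  let f : MapSpace p := AEEqFun.mk (fun _ => ν) aestronglyMeasurable_const
  have hf : f =ᵐ[volP1] fun _ => ν := AEEqFun.coeFn_mk _ _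
  refine ⟨f, fun h hh => MapSpace.ext ((coeFn_smul h f).trans ?_)⟩
  have e1 : ∀ᵐ x ∂volP1, f (extendP1 (h⁻¹ : HQ) x) = ν :=
    (quasiMeasurePreserving_extendP1 h⁻¹).ae hf
  have e2 : ∀ᵐ x ∂volP1, ∃ g ∈ SL2 (ZInv S), IsProjNear h g (extendP1 (h⁻¹ : HQ) x) :=
    (quasiMeasurePreserving_extendP1 h⁻¹).ae (p := fun x => ∃ g ∈ SL2 (ZInv S), IsProjNear h g x)
      (ae_volP1_iff.2 (IsPiecewiseProjective.ae_exists_mem_SL2 hh))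
  rw [EventuallyEq]
  rw [EventuallyEq] at hf
  rw [ae_volP1_iff] at e1 e2 hf ⊢
  filter_upwards [e1, e2, hf] with x h1 ⟨g, hg, hn⟩ h3
  rw [actFun, h1, h3, extendP1_coe] at *
  rw [push_congr (fun z => IsProjNear.mob_eq (isProjNear_projPart hn) hn z)]
  exact hν g fun i j => norm_le_one_of_mem_ZInv hS hp (mem_SL2_iff.1 hg i j)

end invariant

/-! ### Translations force the value `δ_∞` -/

section translations

/-- The matrix of the translation `x ↦ x + t`. -/
def translSL (t : ℚ) : SL(2, ℚ) := ⟨!![1, t; 0, 1], by simp⟩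

theorem mob_translSL_coe {K : Type*} [Field K] [Algebra ℚ K] (t : ℚ) (x : K) :
    mob K (translSL t) (x : OnePoint K) = ((x + algebraMap ℚ K t : K) : OnePoint K) := by
  refine (mob_coe_eq_coe_iff _ _ _).2 ?_
  simp [translSL]

theorem mob_translSL_infty {K : Type*} [Field K] [Algebra ℚ K] (t : ℚ) :
    mob K (translSL t) (∞ : OnePoint K) = ∞ := by
  let _ := Classical.decEq K
  change Matrix.SpecialLinearGroup.mapGL K (translSL t) • (∞ : OnePoint K) = ∞
  rw [OnePoint.smul_infty_eq_ite]
  have : Matrix.SpecialLinearGroup.mapGL K (translSL t) 1 0 = algebraMap ℚ K 0 := rfl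
  rw [this, map_zero, if_pos rfl]

theorem addRight_mem_Gamma {S : Set ℕ} {t : ℚ} (ht : t ∈ ZInv S) :
    Homeomorph.addRight (t : ℝ) ∈ Gamma S := by
  refine ⟨∅, by simp, fun I _ _ => ⟨translSL t, mem_SL2_iff.2 ?_, fun x _ => ?_⟩⟩
  · intro i j
    fin_cases i <;> fin_cases j <;> simp [translSL, ht, zero_mem, one_mem]
  · rw [mob_translSL_coe]
    rfl

theorem isProjNear_addRight (t : ℚ) (x : OnePoint ℝ) :
    IsProjNear (Homeomorph.addRight (t : ℝ)) (translSL t) x := by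
  refine Eventually.of_forall fun y => ?_
  induction y using OnePoint.rec with
  | infty => rw [mob_translSL_infty]; rfl
  | coe y => rw [mob_translSL_coe]; rfl

theorem inv_pow_mem_ZInv {S : Set ℕ} {p : ℕ} (hp : p ∈ S) (n : ℕ) : ((p : ℚ)⁻¹) ^ n ∈ ZInv S :=
  pow_mem (Subring.subset_closure (show (p : ℚ)⁻¹ ∈ {x : ℚ | ∃ q ∈ S, x = (q : ℚ)⁻¹} from
    ⟨p, hp, rfl⟩)) n

variable {p : ℕ} [Fact p.Prime]

/-- The translations by `p⁻ⁿ` move every point of `P¹(ℚ_p)` to `∞`. -/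
theorem tendsto_mob_translSL (y : OnePoint ℚ_[p]) :
    Tendsto (fun n : ℕ => mob ℚ_[p] (translSL ((p : ℚ)⁻¹ ^ n)) y) atTop (𝓝 ∞) := by
  induction y using OnePoint.rec with
  | infty => simp only [mob_translSL_infty, tendsto_const_nhds]
  | coe y =>
    simp only [mob_translSL_coe]
    refine OnePoint.tendsto_coe_infty.comp ?_
    rw [coclosedCompact_eq_cocompact, ← Metric.cobounded_eq_cocompact,
      ← tendsto_norm_atTop_iff_cobounded]
    have hp1 : (1 : ℝ) < p := by exact_mod_cast (Fact.out : p.Prime).one_lt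
    refine tendsto_atTop_mono (fun n => ?_)
      (tendsto_atTop_add_const_right atTop (-‖y‖) (tendsto_pow_atTop_atTop_of_one_lt hp1))
    have h1 : ‖algebraMap ℚ ℚ_[p] ((p : ℚ)⁻¹ ^ n)‖ = (p : ℝ) ^ n := by
      rw [map_pow, map_inv₀, map_natCast, norm_pow, norm_inv, Padic.norm_p, inv_inv]
    have h2 := norm_sub_norm_le (algebraMap ℚ ℚ_[p] ((p : ℚ)⁻¹ ^ n)) (-y)
    rw [h1, norm_neg, sub_neg_eq_add, add_comm _ y] at h2
    linarith

/-- The translations by `p⁻ⁿ` tend to the identity on the line and to `∞` on `P¹(ℚ_p)`, so a map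
that is equivariant under them equals `δ_∞`. -/
theorem ae_eq_dirac_infty {f : MapSpace p}
    (hf : ∀ n : ℕ, ∀ᵐ x : ℝ, f (x : OnePoint ℝ) = push p (translSL ((p : ℚ)⁻¹ ^ n))
      (f ((x - ((p : ℝ)⁻¹) ^ n : ℝ) : OnePoint ℝ))) :
    ∀ᵐ x : ℝ, f (x : OnePoint ℝ) = ⟨Measure.dirac ∞, inferInstance⟩ := by
  have hm : ∀ c : C(OnePoint ℚ_[p], ℝ), AEStronglyMeasurable
      (fun x : ℝ => ∫ y, c y ∂(f (x : OnePoint ℝ) : Measure (OnePoint ℚ_[p]))) volume := fun c =>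
    (f.aestronglyMeasurable_integral c).comp_measurable measurableEmbedding_coeP1.measurable
  have key : ∀ c : C(OnePoint ℚ_[p], ℝ), ∀ᵐ x : ℝ,
      ∫ y, c y ∂(f (x : OnePoint ℝ) : Measure (OnePoint ℚ_[p])) = c ∞ := by
    intro c
    refine ae_eq_of_integral_contDiff_smul_eq ?_ (locallyIntegrable_const _) fun ξ hξ hξ' => ?_
    · refine (locallyIntegrable_const ‖c‖).mono (hm c) (ae_of_all _ fun x => ?_)
      rw [norm_norm]
      exact norm_integral_continuousMap_le _ c
    -- The translation by `p⁻ⁿ` is moved to the test function `ξ`, where it tends to the identity.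
    let G : ℕ → ℝ → ℝ := fun n x => ∫ y, compMob p (translSL ((p : ℚ)⁻¹ ^ n)) c y
      ∂(f (x : OnePoint ℝ) : Measure (OnePoint ℚ_[p]))
    have hG : ∀ n, ∫ x, ξ x • ∫ y, c y ∂(f (x : OnePoint ℝ) : Measure (OnePoint ℚ_[p])) =
        ∫ x, ξ (x + (p : ℝ)⁻¹ ^ n) * G n x := by
      intro n
      rw [← integral_sub_right_eq_self (fun x => ξ (x + (p : ℝ)⁻¹ ^ n) * G n x) ((p : ℝ)⁻¹ ^ n)]
      refine integral_congr_ae ?_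
      filter_upwards [hf n] with x hx
      rw [hx, integral_push, sub_add_cancel, smul_eq_mul]
    have hp0 : (0 : ℝ) ≤ (p : ℝ)⁻¹ := by positivity
    have hp1 : (p : ℝ)⁻¹ < 1 :=
      inv_lt_one_of_one_lt₀ (by exact_mod_cast (Fact.out : p.Prime).one_lt)
    have hGc : ∀ x, Tendsto (fun n => G n x) atTop (𝓝 (c ∞)) := by
      intro x
      have : c ∞ = ∫ _, c ∞ ∂(f (x : OnePoint ℝ) : Measure (OnePoint ℚ_[p])) := by simp
      rw [this]
      refine tendsto_integral_of_dominated_convergence (fun _ => ‖c‖)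
        (fun n => (ContinuousMap.continuous _).aestronglyMeasurable) (integrable_const _)
        (fun n => ae_of_all _ fun y => c.norm_coe_le_norm _) (ae_of_all _ fun y => ?_)
      exact (c.continuous.tendsto ∞).comp (tendsto_mob_translSL y)
    obtain ⟨R, hR⟩ := hξ'.isCompact.isBounded.subset_closedBall 0
    obtain ⟨C, hC⟩ := hξ'.exists_bound_of_continuous hξ.continuous
    have hlim : Tendsto (fun n => ∫ x, ξ (x + (p : ℝ)⁻¹ ^ n) * G n x) atTop
        (𝓝 (∫ x, ξ x • c ∞)) := by
      refine tendsto_integral_of_dominated_convergence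
        ((Metric.closedBall (0 : ℝ) (R + 1)).indicator fun _ => C * ‖c‖) (fun n => ?_) ?_
        (fun n => ae_of_all _ fun x => ?_) (ae_of_all _ fun x => ?_)
      · exact (hξ.continuous.comp (continuous_add_const _)).aestronglyMeasurable.mul (hm _)
      · rw [integrable_indicator_iff measurableSet_closedBall]
        exact integrableOn_const (isCompact_closedBall _ _).measure_lt_top.ne
      · by_cases hx : x ∈ Metric.closedBall (0 : ℝ) (R + 1)
        · rw [indicator_of_mem hx, norm_mul]
          refine mul_le_mul (hC _) ?_ (norm_nonneg _) ((norm_nonneg _).trans (hC 0))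
          exact (norm_integral_continuousMap_le _ _).trans (norm_compMob_le _ _)
        · have h0 : ξ (x + (p : ℝ)⁻¹ ^ n) = 0 := by
            by_contra h0
            have h1 := hR (subset_tsupport ξ h0)
            rw [mem_closedBall_zero_iff, Real.norm_eq_abs, abs_le] at h1
            rw [mem_closedBall_zero_iff, Real.norm_eq_abs, abs_le] at hx
            have h2 : (p : ℝ)⁻¹ ^ n ≤ 1 := pow_le_one₀ hp0 hp1.le
            have h3 : 0 ≤ (p : ℝ)⁻¹ ^ n := pow_nonneg hp0 n
            exact hx ⟨by linarith, by linarith⟩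
          rw [indicator_of_notMem hx, h0, zero_mul, norm_zero]
      · refine Tendsto.mul ?_ (hGc x)
        refine (hξ.continuous.tendsto x).comp ?_
        simpa using (tendsto_pow_atTop_nhds_zero_of_lt_one hp0 hp1).const_add x
    exact tendsto_nhds_unique (tendsto_const_nhds.congr hG) hlim
  have h2 := ae_all_iff.2 fun n => key (TopologicalSpace.denseSeq C(OnePoint ℚ_[p], ℝ) n)
  filter_upwards [h2] with x hx
  refine probP1_ext_of_dense fun n => (hx n).trans ?_
  exact (integral_dirac _ _).symm

theorem ae_eq_push_of_smul_eq {h : HQ} {f : MapSpace p} (hf : h • f = f) :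
    ∀ᵐ x : ℝ, f (x : OnePoint ℝ) = push p
      (projPart h (((h⁻¹ : HQ) : ℝ ≃ₜ ℝ) x : OnePoint ℝ))
      (f (((h⁻¹ : HQ) : ℝ ≃ₜ ℝ) x : OnePoint ℝ)) := by
  have e := coeFn_smul h f
  rw [hf] at e
  exact ae_volP1_iff.1 e

end translations

/-! ### An element that moves `∞` -/

section bump

/-- The homeomorphism of the line that equals `x ↦ 3 - 1 / x` between the two fixed points of this
transformation and the identity elsewhere. The fixed points are the roots of `x ^ 2 - 3 * x + 1`,
which is nonpositive exactly between them. -/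
noncomputable def hyperbolicBump : ℝ ≃ₜ ℝ where
  toFun x := if x ^ 2 - 3 * x + 1 ≤ 0 then 3 - x⁻¹ else x
  invFun y := if y ^ 2 - 3 * y + 1 ≤ 0 then (3 - y)⁻¹ else y
  left_inv x := by
    by_cases hx : x ^ 2 - 3 * x + 1 ≤ 0
    · have hx0 : 0 < x := by nlinarith
      have e : (3 - x⁻¹) ^ 2 - 3 * (3 - x⁻¹) + 1 = (x ^ 2 - 3 * x + 1) / x ^ 2 := by
        field_simp
        ring
      have : (3 - x⁻¹) ^ 2 - 3 * (3 - x⁻¹) + 1 ≤ 0 := by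
        rw [e]
        exact div_nonpos_of_nonpos_of_nonneg hx (by positivity)
      simp only [if_pos hx, if_pos this]
      simp
    · simp only [if_neg hx]
  right_inv y := by
    by_cases hy : y ^ 2 - 3 * y + 1 ≤ 0
    · have hy0 : 0 < 3 - y := by nlinarith
      have e : (3 - y)⁻¹ ^ 2 - 3 * (3 - y)⁻¹ + 1 = (y ^ 2 - 3 * y + 1) / (3 - y) ^ 2 := by
        field_simp
        ring
      have : (3 - y)⁻¹ ^ 2 - 3 * (3 - y)⁻¹ + 1 ≤ 0 := by
        rw [e]
        exact div_nonpos_of_nonpos_of_nonneg hy (by positivity)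
      simp only [if_pos hy, if_pos this]
      simp
    · simp only [if_neg hy]
  continuous_toFun := by
    refine continuous_if_le (by fun_prop) continuous_const ?_ continuousOn_id fun x hx => ?_
    · intro x hx
      have hx0 : 0 < x := by nlinarith [show x ^ 2 - 3 * x + 1 ≤ 0 from hx]
      exact (continuousAt_const.sub (continuousAt_inv₀ hx0.ne')).continuousWithinAt
    · have hx0 : x ≠ 0 := by
        rintro rfl
        norm_num at hx
      change 3 - x⁻¹ = x
      field_simp
      linarith
  continuous_invFun := by
    refine continuous_if_le (by fun_prop) continuous_const ?_ continuousOn_id fun x hx => ?_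
    · intro x hx
      have hx0 : 0 < 3 - x := by nlinarith [show x ^ 2 - 3 * x + 1 ≤ 0 from hx]
      exact ((continuousAt_const.sub continuousAt_id).inv₀ hx0.ne').continuousWithinAt
    · have hx0 : 3 - x ≠ 0 := by
        intro h0
        have h3 : x = 3 := by linarith
        subst h3
        norm_num at hx
      change (3 - x)⁻¹ = x
      field_simp
      linarith

/-- The matrix of `x ↦ 3 - 1 / x`. -/
def hyperbolicSL : SL(2, ℚ) := ⟨!![3, -1; 1, 0], by simp⟩

theorem hyperbolicBump_eq {x : ℝ} (hx : x ^ 2 - 3 * x + 1 ≤ 0) :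
    ((hyperbolicBump x : ℝ) : OnePoint ℝ) = mob ℝ hyperbolicSL (x : OnePoint ℝ) := by
  have hx0 : 0 < x := by nlinarith
  refine ((mob_coe_eq_coe_iff _ _ _).2 ?_).symm
  have e : hyperbolicBump x = 3 - x⁻¹ := if_pos hx
  rw [e]
  simp only [hyperbolicSL]
  simp
  refine ⟨hx0.ne', ?_⟩
  field_simp
  ring

theorem isProjNear_hyperbolicBump {x : ℝ} (hx : x ^ 2 - 3 * x + 1 < 0) :
    IsProjNear hyperbolicBump hyperbolicSL (x : OnePoint ℝ) := by
  rw [IsProjNear, OnePoint.nhds_coe_eq, eventually_map]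
  have : ∀ᶠ y : ℝ in 𝓝 x, y ^ 2 - 3 * y + 1 < 0 :=
    (isOpen_lt (by fun_prop) continuous_const).mem_nhds hx
  filter_upwards [this] with y hy using hyperbolicBump_eq hy.le

theorem hyperbolicBump_mem_Gamma (S : Set ℕ) : hyperbolicBump ∈ Gamma S := by
  have hfin : {x : ℝ | x ^ 2 - 3 * x + 1 = 0}.Finite := by
    refine (Set.toFinite ({(3 + √5) / 2, (3 - √5) / 2} : Set ℝ)).subset fun x hx => ?_
    have hx' : x ^ 2 - 3 * x + 1 = 0 := hx
    have h5 : √5 ^ 2 = 5 := Real.sq_sqrt (by norm_num)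
    have : (x - (3 + √5) / 2) * (x - (3 - √5) / 2) = 0 := by
      linear_combination hx' - h5 / 4
    rcases mul_eq_zero.1 this with h | h
    · exact Or.inl (by linarith)
    · exact Or.inr (by rw [mem_singleton_iff]; linarith)
  refine ⟨hfin.toFinset, by simp, fun I hI hd => ?_⟩
  have hd' : ∀ x ∈ I, x ^ 2 - 3 * x + 1 ≠ 0 := fun x hx h0 =>
    Set.disjoint_left.1 hd hx (by simpa using h0)
  by_cases hex : ∃ x ∈ I, x ^ 2 - 3 * x + 1 ≤ 0
  · obtain ⟨x, hx, hx0⟩ := hex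
    refine ⟨hyperbolicSL, mem_SL2_iff.2 fun i j => ?_, fun y hy => hyperbolicBump_eq ?_⟩
    · fin_cases i <;> fin_cases j <;> simp [hyperbolicSL, zero_mem, one_mem]
    · by_contra hy0
      obtain ⟨z, hz, hz0⟩ := hI.isPreconnected.intermediate_value hx hy
        (f := fun x : ℝ => x ^ 2 - 3 * x + 1) (by fun_prop) ⟨hx0, (not_le.1 hy0).le⟩
      exact hd' z hz hz0
  · push Not at hex
    refine ⟨1, one_mem _, fun x hx => ?_⟩
    rw [mob_one]
    exact congrArg OnePoint.some (if_neg (not_le.2 (hex x hx)))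

theorem mob_hyperbolicSL_infty (K : Type*) [Field K] [Algebra ℚ K] :
    mob K hyperbolicSL (∞ : OnePoint K) ≠ ∞ := by
  let _ := Classical.decEq K
  change Matrix.SpecialLinearGroup.mapGL K hyperbolicSL • (∞ : OnePoint K) ≠ ∞
  rw [OnePoint.smul_infty_eq_ite]
  have : Matrix.SpecialLinearGroup.mapGL K hyperbolicSL 1 0 = algebraMap ℚ K 1 := rfl
  rw [this, map_one, if_neg one_ne_zero]
  exact OnePoint.coe_ne_infty _

/-- When `p ∈ S`, a fixed point would be `δ_∞` almost everywhere because of the translations, but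
`hyperbolicBump` moves `δ_∞` over an interval. -/
theorem not_exists_isFixedPoint_Gamma {p : ℕ} [Fact p.Prime] {S : Set ℕ} (hp : p ∈ S) :
    ¬ ∃ f : MapSpace p, IsFixedPoint ((Gamma S).subgroupOf HQ) f := by
  rintro ⟨f, hf⟩
  have hdir := ae_eq_dirac_infty (f := f) fun n => by
    have hmem := addRight_mem_Gamma (inv_pow_mem_ZInv hp n)
    have e := ae_eq_push_of_smul_eq
      (hf ⟨Homeomorph.addRight (((p : ℚ)⁻¹ ^ n : ℚ) : ℝ), Gamma_le_HQ S hmem⟩ hmem)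
    filter_upwards [e] with x hx
    refine hx.trans ?_
    have hx' : ((Homeomorph.addRight (((p : ℚ)⁻¹ ^ n : ℚ) : ℝ))⁻¹ : ℝ ≃ₜ ℝ) x =
        x - (p : ℝ)⁻¹ ^ n := by
      change x + -(((p : ℚ)⁻¹ ^ n : ℚ) : ℝ) = _
      push_cast
      ring
    have hn := isProjNear_addRight ((p : ℚ)⁻¹ ^ n) ((x - (p : ℝ)⁻¹ ^ n : ℝ) : OnePoint ℝ)
    rw [← push_congr (fun z => IsProjNear.mob_eq (isProjNear_projPart hn) hn z)]
    simp only [Subgroup.coe_inv, hx']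
  have hbump := hyperbolicBump_mem_Gamma S
  let h : HQ := ⟨hyperbolicBump, Gamma_le_HQ S hbump⟩
  have e := ae_eq_push_of_smul_eq (hf h hbump)
  have hdir' := ae_volP1_iff.1 ((quasiMeasurePreserving_extendP1 h⁻¹).ae
    (p := fun x => f x = ⟨Measure.dirac ∞, inferInstance⟩) (ae_volP1_iff.2 hdir))
  have hall := (hdir.and (hdir'.and e))
  obtain ⟨x, hx, h1, h2, h3⟩ := (Measure.dense_of_ae hall).inter_open_nonempty (Ioo 1 2)
    isOpen_Ioo (nonempty_Ioo.2 (by norm_num))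
  have hz : ∃ z : ℝ, ((h⁻¹ : HQ) : ℝ ≃ₜ ℝ) x = z ∧ z ^ 2 - 3 * z + 1 < 0 := by
    have hx0 : x ^ 2 - 3 * x + 1 < 0 := by nlinarith [hx.1, hx.2]
    refine ⟨(3 - x)⁻¹, if_pos hx0.le, ?_⟩
    have h3x : 0 < 3 - x := by linarith [hx.2]
    have e : (3 - x)⁻¹ ^ 2 - 3 * (3 - x)⁻¹ + 1 = (x ^ 2 - 3 * x + 1) / (3 - x) ^ 2 := by
      field_simp
      ring
    rw [e]
    exact div_neg_of_neg_of_pos hx0 (by positivity)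
  obtain ⟨z, hz, hz0⟩ := hz
  rw [extendP1_coe] at h2
  rw [h1, h2, hz] at h3
  have h4 : (Measure.dirac ∞ : Measure (OnePoint ℚ_[p])) =
      Measure.map (mob ℚ_[p] hyperbolicSL) (Measure.dirac ∞) :=
    congrArg Subtype.val (h3.trans (push_congr (fun w => IsProjNear.mob_eq
      (isProjNear_projPart (isProjNear_hyperbolicBump hz0)) (isProjNear_hyperbolicBump hz0) w) _))
  rw [Measure.map_dirac' (continuous_mob _).measurable] at h4
  exact mob_hyperbolicSL_infty ℚ_[p] (dirac_eq_dirac_iff.1 h4).symm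

end bump

/-! ### Failure of co-amenability -/

theorem not_isCoamenableTo {p : ℕ} [Fact p.Prime] {S S' : Set ℕ} (hS : ∀ q ∈ S, q.Prime)
    (hp : p ∈ S') (hp' : p ∉ S) :
    ¬ IsCoamenableTo ((Gamma S).subgroupOf HQ) ((Gamma S').subgroupOf HQ) := fun H =>
  not_exists_isFixedPoint_Gamma hp
    (H _ _ _ (isConvexCompactSpace_mapSpace p) (exists_isFixedPoint_Gamma hS hp'))

/-- The restriction of the action on `K_p` to `Γ_{S'}` separates the two groups already inside
`Γ_{S'}`. -/
theorem not_isCoamenable {p : ℕ} [Fact p.Prime] {S S' : Set ℕ} (hS : ∀ q ∈ S, q.Prime)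
    (hp : p ∈ S') (hp' : p ∉ S) : ¬ IsCoamenable ((Gamma S).subgroupOf (Gamma S')) := by
  intro H
  let i : Gamma S' →* HQ := Subgroup.inclusion (Gamma_le_HQ S')
  let _ : MulAction (Gamma S') (MapSpace p) := MulAction.compHom (MapSpace p) i
  have hK := isConvexCompactSpace_mapSpace p
  have hK' : IsConvexCompactSpace (Gamma S') (MapSpace p) (WeakDual ℝ (L1C p)) (pairing p) :=
    { injective := hK.injective
      isCompact := hK.isCompact
      convex := hK.convex
      continuous_smul := fun g => hK.continuous_smul (i g)
      affine_smul := fun g => hK.affine_smul (i g) }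
  obtain ⟨f, hf⟩ := exists_isFixedPoint_Gamma hS hp'
  obtain ⟨k, hk⟩ := H _ _ _ hK' ⟨f, fun g hg => hf (i g) hg⟩
  exact not_exists_isFixedPoint_Gamma hp ⟨k, fun g hg => hk ⟨g, hg⟩⟩

theorem mainTheorem1 (S S' : Set ℕ) (hS : ∀ q ∈ S, q.Prime) (hS' : ∀ q ∈ S', q.Prime) :
    (Gamma S ≤ HQ ∧ Gamma S' ≤ HQ) ∧
    (∀ (p : ℕ) [Fact p.Prime], p ∈ S' \ S →
      IsConvexCompactSpace HQ (MapSpace p) (WeakDual ℝ (L1C p)) (pairing p) ∧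
      (∃ f : MapSpace p, IsFixedPoint ((Gamma S).subgroupOf HQ) f) ∧
      (¬ ∃ f : MapSpace p, IsFixedPoint ((Gamma S').subgroupOf HQ) f) ∧
      ¬ IsCoamenableTo ((Gamma S).subgroupOf HQ) ((Gamma S').subgroupOf HQ)) ∧
    (S ⊂ S' → Gamma S ≤ Gamma S' ∧ ¬ IsCoamenable ((Gamma S).subgroupOf (Gamma S'))) := by
  refine ⟨⟨Gamma_le_HQ S, Gamma_le_HQ S'⟩, fun p _ hp => ?_, fun hlt => ⟨Gamma_mono hlt.1, ?_⟩⟩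
  · exact ⟨isConvexCompactSpace_mapSpace p, exists_isFixedPoint_Gamma hS hp.2,
      not_exists_isFixedPoint_Gamma hp.1, not_isCoamenableTo hS hp.1 hp.2⟩
  · obtain ⟨p, hp, hp'⟩ := Set.exists_of_ssubset hlt
    have : Fact p.Prime := ⟨hS' p hp⟩
    exact not_isCoamenable hS hp hp'
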